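/- **Theorem.** There is an algorithm which, given a prime $p$, a target $k\in\mathbb{Z}/p\mathbb{Z}$ and elements $a_1,\dots,a_{p-1}\in\mathbb{Z}/p\mathbb{Z}$, all nonzero, finds a set $I\subseteq\{1,\dots,p-1\}$ with $\sum_{i\in I}a_i=k$ in $O(p\log\log p)$ time on a word RAM with words of $O(\log p)$ bits. Explicitly: there are a single word-RAM program $P$, a constant $c\in\mathbb{N}$ and a function $T:\mathbb{N}\to\mathbb{N}$ with $T(n)=O(n\log\log n)$ as $n\to\infty$ such that, for every prime $p$, every word length $w$ with $2^w\ge p^c$, every $k\in\mathbb{Z}/p\mathbb{Z}$ and all nonzero $a_1,\dots,a_{p-1}\in\mathbb{Z}/p\mathbb{Z}$, the program $P$ with $w$-bit words, started on the input $(p,k,a_1,\dots,a_{p-1})$, halts after at most $T(p)$ steps and outputs the indicator vector of a set $I\subseteq\{1,\dots,p-1\}$ with $\sum_{i\in I}a_i=k$. Here the word RAM has finitely many registers and arrays of $w$-bit words, initially zero apart from the input; constants, register accesses, array accesses (reading or writing a cell), additions, subtractions, multiplications, integer divisions, remainders, comparisons, assignments and tests of a branch or loop cost one step each. -/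

import Mathlib

open Filter Asymptotics

/-! A word RAM: finitely many registers and arrays of `w`-bit words, structured control flow,
unit cost for every elementary operation. A program is a finite piece of syntax, so it mentions
only finitely many registers and arrays, and it does not depend on the input or on `w`. -/

namespace WordRAM

/-- The elementary operations on words. -/
inductive BinOp where
  | add | sub | mul | div | mod | lt | eq

/-- Value of an elementary operation on `w`-bit words. Addition and multiplication are taken
modulo `2 ^ w`; subtraction is cut off at zero; `div` and `mod` are quotient and remainder
(with values `0` and `a` when dividing `a` by zero); comparisons return `1` or `0`. -/
def BinOp.eval (w : ℕ) : BinOp → ℕ → ℕ → ℕ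
  | .add, a, b => (a + b) % 2 ^ w
  | .sub, a, b => a - b
  | .mul, a, b => (a * b) % 2 ^ w
  | .div, a, b => a / b
  | .mod, a, b => a % b
  | .lt, a, b => (if a < b then 1 else 0) % 2 ^ w
  | .eq, a, b => (if a = b then 1 else 0) % 2 ^ w

/-- Expressions: constants, registers, array cells `arr j [e]`, elementary operations. -/
inductive Expr where
  | const (n : ℕ)
  | reg (r : ℕ)
  | load (j : ℕ) (e : Expr)
  | op (o : BinOp) (e₁ e₂ : Expr)

/-- Programs. -/
inductive Cmd where
  | skip
  | assign (r : ℕ) (e : Expr)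
  | store (j : ℕ) (index value : Expr)
  | seq (c₁ c₂ : Cmd)
  | branch (test : Expr) (c₁ c₂ : Cmd)
  | loop (test : Expr) (body : Cmd)

/-- Contents of the registers and of the arrays. -/
@[ext]
structure State where
  reg : ℕ → ℕ
  arr : ℕ → ℕ → ℕ

/-- Value of an expression. -/
def Expr.eval (w : ℕ) (s : State) : Expr → ℕ
  | .const n => n % 2 ^ w
  | .reg r => s.reg r
  | .load j e => s.arr j (e.eval w s)
  | .op o e₁ e₂ => o.eval w (e₁.eval w s) (e₂.eval w s)

/-- Number of steps for evaluating an expression: one for each constant, register access,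
array access and elementary operation in it. -/
def Expr.cost : Expr → ℕ
  | .const _ => 1
  | .reg _ => 1
  | .load _ e => e.cost + 1
  | .op _ e₁ e₂ => e₁.cost + e₂.cost + 1

/-- Overwrite register `r` by `v`. -/
def State.setReg (s : State) (r v : ℕ) : State where
  reg := Function.update s.reg r v
  arr := s.arr

/-- Overwrite cell `i` of array `j` by `v`. -/
def State.setArr (s : State) (j i v : ℕ) : State where
  reg := s.reg
  arr := Function.update s.arr j (Function.update (s.arr j) i v)

/-- `Exec w c s t s'`: with `w`-bit words, the program `c` started in the state `s` halts in the
state `s'` after exactly `t` steps. A test counts as true when its value is nonzero. -/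
inductive Exec (w : ℕ) : Cmd → State → ℕ → State → Prop where
  | skip (s : State) : Exec w .skip s 1 s
  | assign (r : ℕ) (e : Expr) (s : State) :
      Exec w (.assign r e) s (e.cost + 1) (s.setReg r (e.eval w s))
  | store (j : ℕ) (e₁ e₂ : Expr) (s : State) :
      Exec w (.store j e₁ e₂) s (e₁.cost + e₂.cost + 1)
        (s.setArr j (e₁.eval w s) (e₂.eval w s))
  | seq {c₁ c₂ : Cmd} {s s₁ s₂ : State} {t₁ t₂ : ℕ}
      (h₁ : Exec w c₁ s t₁ s₁) (h₂ : Exec w c₂ s₁ t₂ s₂) :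
      Exec w (.seq c₁ c₂) s (t₁ + t₂) s₂
  | branch_true {e : Expr} {c₁ c₂ : Cmd} {s s₁ : State} {t : ℕ}
      (he : e.eval w s ≠ 0) (h : Exec w c₁ s t s₁) :
      Exec w (.branch e c₁ c₂) s (e.cost + 1 + t) s₁
  | branch_false {e : Expr} {c₁ c₂ : Cmd} {s s₁ : State} {t : ℕ}
      (he : e.eval w s = 0) (h : Exec w c₂ s t s₁) :
      Exec w (.branch e c₁ c₂) s (e.cost + 1 + t) s₁
  | loop_done {e : Expr} {c : Cmd} {s : State}
      (he : e.eval w s = 0) :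
      Exec w (.loop e c) s (e.cost + 1) s
  | loop_step {e : Expr} {c : Cmd} {s s₁ s₂ : State} {t₁ t₂ : ℕ}
      (he : e.eval w s ≠ 0) (h₁ : Exec w c s t₁ s₁) (h₂ : Exec w (.loop e c) s₁ t₂ s₂) :
      Exec w (.loop e c) s (e.cost + 1 + t₁ + t₂) s₂

end WordRAM

/-- Input of the subset-sum problem: register `0` holds `p`, register `1` holds the target `k`,
cells `0, …, p - 2` of array `0` hold the given elements, all residues being represented in
`{0, …, p - 1}`; everything else is zero. -/
def subsetSumInput (p : ℕ) (k : ZMod p) (a : Fin (p - 1) → ZMod p) : WordRAM.State where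
  reg r := if r = 0 then p else if r = 1 then k.val else 0
  arr j i := if h : j = 0 ∧ i < p - 1 then (a ⟨i, h.2⟩).val else 0

/-- The cells `0, …, p - 2` of array `1` hold the indicator function of `I`. -/
def IsOutput (p : ℕ) (s : WordRAM.State) (I : Finset (Fin (p - 1))) : Prop :=
  ∀ i : Fin (p - 1), s.arr 1 i = if i ∈ I then 1 else 0

/-- With `w`-bit words, the program `P` solves within `T` steps every instance of the following
problem: given `k ∈ ℤ/p` and nonzero `a₁, …, a_{p-1} ∈ ℤ/p`, find a set `I` of indices with
`∑_{i ∈ I} aᵢ = k`. -/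
def SolvesSubsetSum (P : WordRAM.Cmd) (w p T : ℕ) : Prop :=
  ∀ (k : ZMod p) (a : Fin (p - 1) → ZMod p), (∀ i, a i ≠ 0) →
    ∃ (t : ℕ) (s : WordRAM.State), WordRAM.Exec w P (subsetSumInput p k a) t s ∧ t ≤ T ∧
      ∃ I : Finset (Fin (p - 1)), IsOutput p s I ∧ ∑ i ∈ I, a i = k

/-! The program runs in linear time; `log log n` is eventually at least 1, so this implies the
stated bound.

Multiplying by a unit and replacing elements by their negatives only transforms the target, since
negating an element amounts to toggling its membership in the set. So one may assume that all
elements lie in `[1, p/2]` and that the most frequent value, occurring `h` times, is `1`.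

The elements are turned into "steps". Each of the `h` ones is a step. Then `m` pairs of different
elements with the same quotient by `h` are formed: taking the larger instead of the smaller element
of a pair moves the sum by a number between `1` and `h`. Pairing stops once `h + m ≥ p/8`. This must
happen, because the elements left waiting have one value, hence at most `h` elements, for each of
about `p/(2h)` quotients (`card_unpaired_le`, `Pairing.large`). Each remaining element is a step of
size between `2` and `p/2`. There are `p - 1 - m` steps in all.

Now a set of reachable residues grows from `{0}`, one step `d` at a time, stored as a disjoint union
of cyclic intervals. A nonempty proper subset of `ℤ/p` is not closed under adding `d`, so each step
can add a residue. Ones and pairs never exceed the size already reached, so they keep a single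
interval `[0, z)` and bring it to length at least `1 + h + m > p/8`. While `d ≤ z`, a remaining step
prolongs this interval by `d ≥ 2`. The first step with `z < d ≤ p/2` adds a disjoint translate of
it. Either effect makes up for the `m` steps lost by pairing. From then on all intervals have length
at least `p/8`, so there are at most 8 and a step costs `O(1)` plus the number of new residues
(`wp_stepCmd`, `Progress`, `wp_growCmd`).

Each residue remembers the number of the step that reached it, and its predecessor was reached
strictly earlier. Following predecessors back from the target therefore uses each step at most once.
Step numbers start at `2`, because mark `1` is reserved for the residue `0` and mark `0` means "not
reached". -/

namespace WordRAM

/-! ### Weakest preconditions with running time -/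

/-- From the state `s` the command `c` halts after some number of steps `t` in some state `s'`
with `Q t s'`. -/
def Wp (w : ℕ) (c : Cmd) (s : State) (Q : ℕ → State → Prop) : Prop :=
  ∃ t s', Exec w c s t s' ∧ Q t s'

@[simp] theorem wp_skip {w : ℕ} {s : State} {Q : ℕ → State → Prop} :
    Wp w .skip s Q ↔ Q 1 s := by
  constructor
  · rintro ⟨t, s', ⟨⟩, hq⟩
    exact hq
  · exact fun hq => ⟨_, _, .skip s, hq⟩

@[simp] theorem wp_assign {w r : ℕ} {e : Expr} {s : State} {Q : ℕ → State → Prop} :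
    Wp w (.assign r e) s Q ↔ Q (e.cost + 1) (s.setReg r (e.eval w s)) := by
  constructor
  · rintro ⟨t, s', ⟨⟩, hq⟩
    exact hq
  · exact fun hq => ⟨_, _, .assign r e s, hq⟩

@[simp] theorem wp_store {w j : ℕ} {e₁ e₂ : Expr} {s : State} {Q : ℕ → State → Prop} :
    Wp w (.store j e₁ e₂) s Q ↔
      Q (e₁.cost + e₂.cost + 1) (s.setArr j (e₁.eval w s) (e₂.eval w s)) := by
  constructor
  · rintro ⟨t, s', ⟨⟩, hq⟩
    exact hq
  · exact fun hq => ⟨_, _, .store j e₁ e₂ s, hq⟩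

@[simp] theorem wp_seq {w : ℕ} {c₁ c₂ : Cmd} {s : State} {Q : ℕ → State → Prop} :
    Wp w (.seq c₁ c₂) s Q ↔ Wp w c₁ s fun t₁ s₁ => Wp w c₂ s₁ fun t₂ s₂ => Q (t₁ + t₂) s₂ := by
  constructor
  · rintro ⟨t, s', hex, hq⟩
    cases hex with
    | seq h₁ h₂ => exact ⟨_, _, h₁, _, _, h₂, hq⟩
  · rintro ⟨t₁, s₁, h₁, t₂, s₂, h₂, hq⟩
    exact ⟨_, _, .seq h₁ h₂, hq⟩

@[simp] theorem wp_branch {w : ℕ} {e : Expr} {c₁ c₂ : Cmd} {s : State} {Q : ℕ → State → Prop} :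
    Wp w (.branch e c₁ c₂) s Q ↔
      (e.eval w s ≠ 0 → Wp w c₁ s fun t s' => Q (e.cost + 1 + t) s') ∧
      (e.eval w s = 0 → Wp w c₂ s fun t s' => Q (e.cost + 1 + t) s') := by
  constructor
  · rintro ⟨t, s', hex, hq⟩
    cases hex with
    | branch_true he h => exact ⟨fun _ => ⟨_, _, h, hq⟩, fun h0 => absurd h0 he⟩
    | branch_false he h => exact ⟨fun h0 => absurd he h0, fun _ => ⟨_, _, h, hq⟩⟩
  · rintro ⟨h₁, h₂⟩
    by_cases he : e.eval w s = 0
    · obtain ⟨t, s', h, hq⟩ := h₂ he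
      exact ⟨_, _, .branch_false he h, hq⟩
    · obtain ⟨t, s', h, hq⟩ := h₁ he
      exact ⟨_, _, .branch_true he h, hq⟩

/-- The program variables by name: registers and arrays. -/
structure Vars where
  (p k i x h b c g m y d t o n z j : ℕ)
  (inp out res flip cnt gad del head next mark start len sel : ℕ → ℕ)

/-- The state with the given values of the program variables, all else being zero. -/
def Vars.st (v : Vars) : State where
  reg r := match r with
    | 0 => v.p
    | 1 => v.k
    | 2 => v.i
    | 3 => v.x
    | 4 => v.h
    | 5 => v.b
    | 6 => v.c
    | 7 => v.g
    | 8 => v.m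
    | 9 => v.y
    | 10 => v.d
    | 11 => v.t
    | 12 => v.o
    | 13 => v.n
    | 14 => v.z
    | 15 => v.j
    | _ => 0
  arr j := match j with
    | 0 => v.inp
    | 1 => v.out
    | 2 => v.res
    | 3 => v.flip
    | 4 => v.cnt
    | 5 => v.gad
    | 6 => v.del
    | 7 => v.head
    | 8 => v.next
    | 9 => v.mark
    | 10 => v.start
    | 11 => v.len
    | 12 => v.sel
    | _ => fun _ => 0

/-! ### Updates of states expressed through the named variables -/

theorem setReg_eq {s s' : State} {r a : ℕ} (h : s'.reg r = a)
    (h' : ∀ q, q ≠ r → s'.reg q = s.reg q) (ha : s'.arr = s.arr) : s.setReg r a = s' := by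
  refine State.ext (funext fun q => ?_) ha.symm
  by_cases hq : q = r
  · subst hq
    simp [State.setReg, h]
  · simp [State.setReg, hq, h' q hq]

theorem setArr_eq {s s' : State} {j i a : ℕ} (h : s'.reg = s.reg)
    (ha : s'.arr j = Function.update (s.arr j) i a)
    (h' : ∀ q, q ≠ j → s'.arr q = s.arr q) : s.setArr j i a = s' := by
  refine State.ext h.symm (funext fun q => ?_)
  by_cases hq : q = j
  · subst hq
    simp [State.setArr, ha]
  · simp [State.setArr, hq, h' q hq]

namespace Vars

variable (v : Vars)

@[simp] theorem st_setReg_k (a : ℕ) : v.st.setReg 1 a = {v with k := a}.st :=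
  setReg_eq rfl (fun r h => by dsimp only [st]; split <;> first | rfl | exact absurd rfl h) rfl

@[simp] theorem st_setReg_i (a : ℕ) : v.st.setReg 2 a = {v with i := a}.st :=
  setReg_eq rfl (fun r h => by dsimp only [st]; split <;> first | rfl | exact absurd rfl h) rfl

@[simp] theorem st_setReg_x (a : ℕ) : v.st.setReg 3 a = {v with x := a}.st :=
  setReg_eq rfl (fun r h => by dsimp only [st]; split <;> first | rfl | exact absurd rfl h) rfl

@[simp] theorem st_setReg_h (a : ℕ) : v.st.setReg 4 a = {v with h := a}.st :=
  setReg_eq rfl (fun r h => by dsimp only [st]; split <;> first | rfl | exact absurd rfl h) rfl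

@[simp] theorem st_setReg_b (a : ℕ) : v.st.setReg 5 a = {v with b := a}.st :=
  setReg_eq rfl (fun r h => by dsimp only [st]; split <;> first | rfl | exact absurd rfl h) rfl

@[simp] theorem st_setReg_c (a : ℕ) : v.st.setReg 6 a = {v with c := a}.st :=
  setReg_eq rfl (fun r h => by dsimp only [st]; split <;> first | rfl | exact absurd rfl h) rfl

@[simp] theorem st_setReg_g (a : ℕ) : v.st.setReg 7 a = {v with g := a}.st :=
  setReg_eq rfl (fun r h => by dsimp only [st]; split <;> first | rfl | exact absurd rfl h) rfl

@[simp] theorem st_setReg_m (a : ℕ) : v.st.setReg 8 a = {v with m := a}.st :=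
  setReg_eq rfl (fun r h => by dsimp only [st]; split <;> first | rfl | exact absurd rfl h) rfl

@[simp] theorem st_setReg_y (a : ℕ) : v.st.setReg 9 a = {v with y := a}.st :=
  setReg_eq rfl (fun r h => by dsimp only [st]; split <;> first | rfl | exact absurd rfl h) rfl

@[simp] theorem st_setReg_d (a : ℕ) : v.st.setReg 10 a = {v with d := a}.st :=
  setReg_eq rfl (fun r h => by dsimp only [st]; split <;> first | rfl | exact absurd rfl h) rfl

@[simp] theorem st_setReg_t (a : ℕ) : v.st.setReg 11 a = {v with t := a}.st :=
  setReg_eq rfl (fun r h => by dsimp only [st]; split <;> first | rfl | exact absurd rfl h) rfl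

@[simp] theorem st_setReg_o (a : ℕ) : v.st.setReg 12 a = {v with o := a}.st :=
  setReg_eq rfl (fun r h => by dsimp only [st]; split <;> first | rfl | exact absurd rfl h) rfl

@[simp] theorem st_setReg_n (a : ℕ) : v.st.setReg 13 a = {v with n := a}.st :=
  setReg_eq rfl (fun r h => by dsimp only [st]; split <;> first | rfl | exact absurd rfl h) rfl

@[simp] theorem st_setReg_z (a : ℕ) : v.st.setReg 14 a = {v with z := a}.st :=
  setReg_eq rfl (fun r h => by dsimp only [st]; split <;> first | rfl | exact absurd rfl h) rfl

@[simp] theorem st_setReg_j (a : ℕ) : v.st.setReg 15 a = {v with j := a}.st :=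
  setReg_eq rfl (fun r h => by dsimp only [st]; split <;> first | rfl | exact absurd rfl h) rfl

@[simp] theorem st_setArr_out (i a : ℕ) :
    v.st.setArr 1 i a = {v with out := Function.update v.out i a}.st :=
  setArr_eq rfl rfl (fun r h => by dsimp only [st]; split <;> first | rfl | exact absurd rfl h)

@[simp] theorem st_setArr_res (i a : ℕ) :
    v.st.setArr 2 i a = {v with res := Function.update v.res i a}.st :=
  setArr_eq rfl rfl (fun r h => by dsimp only [st]; split <;> first | rfl | exact absurd rfl h)

@[simp] theorem st_setArr_flip (i a : ℕ) :
    v.st.setArr 3 i a = {v with flip := Function.update v.flip i a}.st :=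
  setArr_eq rfl rfl (fun r h => by dsimp only [st]; split <;> first | rfl | exact absurd rfl h)

@[simp] theorem st_setArr_cnt (i a : ℕ) :
    v.st.setArr 4 i a = {v with cnt := Function.update v.cnt i a}.st :=
  setArr_eq rfl rfl (fun r h => by dsimp only [st]; split <;> first | rfl | exact absurd rfl h)

@[simp] theorem st_setArr_gad (i a : ℕ) :
    v.st.setArr 5 i a = {v with gad := Function.update v.gad i a}.st :=
  setArr_eq rfl rfl (fun r h => by dsimp only [st]; split <;> first | rfl | exact absurd rfl h)

@[simp] theorem st_setArr_del (i a : ℕ) :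
    v.st.setArr 6 i a = {v with del := Function.update v.del i a}.st :=
  setArr_eq rfl rfl (fun r h => by dsimp only [st]; split <;> first | rfl | exact absurd rfl h)

@[simp] theorem st_setArr_head (i a : ℕ) :
    v.st.setArr 7 i a = {v with head := Function.update v.head i a}.st :=
  setArr_eq rfl rfl (fun r h => by dsimp only [st]; split <;> first | rfl | exact absurd rfl h)

@[simp] theorem st_setArr_next (i a : ℕ) :
    v.st.setArr 8 i a = {v with next := Function.update v.next i a}.st :=
  setArr_eq rfl rfl (fun r h => by dsimp only [st]; split <;> first | rfl | exact absurd rfl h)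

@[simp] theorem st_setArr_mark (i a : ℕ) :
    v.st.setArr 9 i a = {v with mark := Function.update v.mark i a}.st :=
  setArr_eq rfl rfl (fun r h => by dsimp only [st]; split <;> first | rfl | exact absurd rfl h)

@[simp] theorem st_setArr_start (i a : ℕ) :
    v.st.setArr 10 i a = {v with start := Function.update v.start i a}.st :=
  setArr_eq rfl rfl (fun r h => by dsimp only [st]; split <;> first | rfl | exact absurd rfl h)

@[simp] theorem st_setArr_len (i a : ℕ) :
    v.st.setArr 11 i a = {v with len := Function.update v.len i a}.st :=
  setArr_eq rfl rfl (fun r h => by dsimp only [st]; split <;> first | rfl | exact absurd rfl h)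

@[simp] theorem st_setArr_sel (i a : ℕ) :
    v.st.setArr 12 i a = {v with sel := Function.update v.sel i a}.st :=
  setArr_eq rfl rfl (fun r h => by dsimp only [st]; split <;> first | rfl | exact absurd rfl h)

end Vars

/-! ### Notation, values and costs of expressions -/

instance : Add Expr := ⟨.op .add⟩
instance : Sub Expr := ⟨.op .sub⟩
instance : Mul Expr := ⟨.op .mul⟩
instance : Div Expr := ⟨.op .div⟩
instance : Mod Expr := ⟨.op .mod⟩
instance (n : ℕ) : OfNat Expr n := ⟨.const n⟩

/-- The test `a < b`. -/
def Expr.lt (a b : Expr) : Expr := .op .lt a b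

/-- The test `a = b`. -/
def Expr.eq (a b : Expr) : Expr := .op .eq a b

/-- The number of different words, kept opaque for arithmetic tactics. -/
@[irreducible] def wsize (w : ℕ) : ℕ := 2 ^ w

theorem wsize_eq (w : ℕ) : wsize w = 2 ^ w := by unfold wsize; rfl

open Classical in
/-- The truth value of `P` as a number. -/
noncomputable def ind (P : Prop) : ℕ := if P then 1 else 0

@[simp] theorem ind_eq_zero {P : Prop} : ind P = 0 ↔ ¬ P := by
  by_cases h : P <;> simp [ind, h]

theorem ind_eq {P : Prop} [Decidable P] : ind P = if P then 1 else 0 := by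
  by_cases h : P <;> simp [ind, h]

theorem ind_le {P : Prop} : ind P ≤ 1 := by
  by_cases h : P <;> simp [ind, h]

@[simp] theorem ind_mul {P R : Prop} : ind P * ind R = ind (P ∧ R) := by
  by_cases h : P <;> by_cases h' : R <;> simp [ind, h, h']

section Eval

variable (w : ℕ) (s : State) (a b : Expr)

@[simp] theorem eval_add : (a + b).eval w s = (a.eval w s + b.eval w s) % wsize w := by
  rw [wsize_eq]; rfl
@[simp] theorem eval_sub : (a - b).eval w s = a.eval w s - b.eval w s := rfl
@[simp] theorem eval_mul : (a * b).eval w s = (a.eval w s * b.eval w s) % wsize w := by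
  rw [wsize_eq]; rfl
@[simp] theorem eval_div : (a / b).eval w s = a.eval w s / b.eval w s := rfl
@[simp] theorem eval_mod : (a % b).eval w s = a.eval w s % b.eval w s := rfl
@[simp] theorem eval_zero : (0 : Expr).eval w s = 0 := Nat.zero_mod _
@[simp] theorem eval_one : (1 : Expr).eval w s = 1 % wsize w := by
  rw [wsize_eq]; rfl
@[simp] theorem eval_two : (2 : Expr).eval w s = 2 % wsize w := by
  rw [wsize_eq]; rfl
@[simp] theorem eval_eight : (8 : Expr).eval w s = 8 % wsize w := by
  rw [wsize_eq]; rfl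
@[simp] theorem eval_lt : (a.lt b).eval w s = ind (a.eval w s < b.eval w s) % wsize w := by
  rw [wsize_eq, ind_eq]; rfl
@[simp] theorem eval_eq : (a.eq b).eval w s = ind (a.eval w s = b.eval w s) % wsize w := by
  rw [wsize_eq, ind_eq]; rfl
@[simp] theorem cost_add : (a + b).cost = a.cost + b.cost + 1 := rfl
@[simp] theorem cost_sub : (a - b).cost = a.cost + b.cost + 1 := rfl
@[simp] theorem cost_mul : (a * b).cost = a.cost + b.cost + 1 := rfl
@[simp] theorem cost_div : (a / b).cost = a.cost + b.cost + 1 := rfl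
@[simp] theorem cost_mod : (a % b).cost = a.cost + b.cost + 1 := rfl
@[simp] theorem cost_lt : (a.lt b).cost = a.cost + b.cost + 1 := rfl
@[simp] theorem cost_eq : (a.eq b).cost = a.cost + b.cost + 1 := rfl
@[simp] theorem cost_zero : (0 : Expr).cost = 1 := rfl
@[simp] theorem cost_one : (1 : Expr).cost = 1 := rfl
@[simp] theorem cost_two : (2 : Expr).cost = 1 := rfl
@[simp] theorem cost_eight : (8 : Expr).cost = 1 := rfl

@[simp] theorem eval_reg (r : ℕ) : (Expr.reg r).eval w s = s.reg r := rfl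
@[simp] theorem eval_load (j : ℕ) (e : Expr) :
    (Expr.load j e).eval w s = s.arr j (e.eval w s) := rfl
@[simp] theorem cost_reg (r : ℕ) : (Expr.reg r).cost = 1 := rfl
@[simp] theorem cost_load (j : ℕ) (e : Expr) : (Expr.load j e).cost = e.cost + 1 := rfl

theorem ind_mod_wsize {w : ℕ} (hw : 2 ≤ wsize w) (P : Prop) : ind P % wsize w = ind P :=
  Nat.mod_eq_of_lt (ind_le.trans_lt hw)

end Eval

/-- Register `p`. -/
abbrev rp : Expr := .reg 0
/-- Register `k`. -/
abbrev rk : Expr := .reg 1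
/-- Register `i`. -/
abbrev ri : Expr := .reg 2
/-- Register `x`. -/
abbrev rx : Expr := .reg 3
/-- Register `h`. -/
abbrev rh : Expr := .reg 4
/-- Register `b`. -/
abbrev rb : Expr := .reg 5
/-- Register `c`. -/
abbrev rc : Expr := .reg 6
/-- Register `g`. -/
abbrev rg : Expr := .reg 7
/-- Register `m`. -/
abbrev rm : Expr := .reg 8
/-- Register `y`. -/
abbrev ry : Expr := .reg 9
/-- Register `d`. -/
abbrev rd : Expr := .reg 10
/-- Register `t`. -/
abbrev rt : Expr := .reg 11
/-- Register `o`. -/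
abbrev ro : Expr := .reg 12
/-- Register `n`. -/
abbrev rn : Expr := .reg 13
/-- Register `z`. -/
abbrev rz : Expr := .reg 14
/-- Register `j`. -/
abbrev rj : Expr := .reg 15
/-- Cell `e` of the array `inp`. -/
abbrev ainp (e : Expr) : Expr := .load 0 e
/-- Cell `e` of the array `res`. -/
abbrev ares (e : Expr) : Expr := .load 2 e
/-- Cell `e` of the array `flip`. -/
abbrev aflip (e : Expr) : Expr := .load 3 e
/-- Cell `e` of the array `cnt`. -/
abbrev acnt (e : Expr) : Expr := .load 4 e
/-- Cell `e` of the array `gad`. -/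
abbrev agad (e : Expr) : Expr := .load 5 e
/-- Cell `e` of the array `del`. -/
abbrev adel (e : Expr) : Expr := .load 6 e
/-- Cell `e` of the array `head`. -/
abbrev ahead (e : Expr) : Expr := .load 7 e
/-- Cell `e` of the array `next`. -/
abbrev anext (e : Expr) : Expr := .load 8 e
/-- Cell `e` of the array `mark`. -/
abbrev amark (e : Expr) : Expr := .load 9 e
/-- Cell `e` of the array `start`. -/
abbrev astart (e : Expr) : Expr := .load 10 e
/-- Cell `e` of the array `len`. -/
abbrev alen (e : Expr) : Expr := .load 11 e
/-- Cell `e` of the array `sel`. -/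
abbrev asel (e : Expr) : Expr := .load 12 e
/-- Assignment to `k`. -/
abbrev set_k (e : Expr) : Cmd := .assign 1 e
/-- Assignment to `i`. -/
abbrev set_i (e : Expr) : Cmd := .assign 2 e
/-- Assignment to `x`. -/
abbrev set_x (e : Expr) : Cmd := .assign 3 e
/-- Assignment to `h`. -/
abbrev set_h (e : Expr) : Cmd := .assign 4 e
/-- Assignment to `b`. -/
abbrev set_b (e : Expr) : Cmd := .assign 5 e
/-- Assignment to `c`. -/
abbrev set_c (e : Expr) : Cmd := .assign 6 e
/-- Assignment to `g`. -/
abbrev set_g (e : Expr) : Cmd := .assign 7 e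
/-- Assignment to `m`. -/
abbrev set_m (e : Expr) : Cmd := .assign 8 e
/-- Assignment to `y`. -/
abbrev set_y (e : Expr) : Cmd := .assign 9 e
/-- Assignment to `d`. -/
abbrev set_d (e : Expr) : Cmd := .assign 10 e
/-- Assignment to `t`. -/
abbrev set_t (e : Expr) : Cmd := .assign 11 e
/-- Assignment to `o`. -/
abbrev set_o (e : Expr) : Cmd := .assign 12 e
/-- Assignment to `n`. -/
abbrev set_n (e : Expr) : Cmd := .assign 13 e
/-- Assignment to `z`. -/
abbrev set_z (e : Expr) : Cmd := .assign 14 e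
/-- Assignment to `j`. -/
abbrev set_j (e : Expr) : Cmd := .assign 15 e
/-- Assignment to cell `e` of `out`. -/
abbrev put_out (e f : Expr) : Cmd := .store 1 e f
/-- Assignment to cell `e` of `res`. -/
abbrev put_res (e f : Expr) : Cmd := .store 2 e f
/-- Assignment to cell `e` of `flip`. -/
abbrev put_flip (e f : Expr) : Cmd := .store 3 e f
/-- Assignment to cell `e` of `cnt`. -/
abbrev put_cnt (e f : Expr) : Cmd := .store 4 e f
/-- Assignment to cell `e` of `gad`. -/
abbrev put_gad (e f : Expr) : Cmd := .store 5 e f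
/-- Assignment to cell `e` of `del`. -/
abbrev put_del (e f : Expr) : Cmd := .store 6 e f
/-- Assignment to cell `e` of `head`. -/
abbrev put_head (e f : Expr) : Cmd := .store 7 e f
/-- Assignment to cell `e` of `next`. -/
abbrev put_next (e f : Expr) : Cmd := .store 8 e f
/-- Assignment to cell `e` of `mark`. -/
abbrev put_mark (e f : Expr) : Cmd := .store 9 e f
/-- Assignment to cell `e` of `start`. -/
abbrev put_start (e f : Expr) : Cmd := .store 10 e f
/-- Assignment to cell `e` of `len`. -/
abbrev put_len (e f : Expr) : Cmd := .store 11 e f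
/-- Assignment to cell `e` of `sel`. -/
abbrev put_sel (e f : Expr) : Cmd := .store 12 e f

section Reads

variable (v : Vars)

@[simp] theorem st_reg_p : v.st.reg 0 = v.p := rfl
@[simp] theorem st_reg_k : v.st.reg 1 = v.k := rfl
@[simp] theorem st_reg_i : v.st.reg 2 = v.i := rfl
@[simp] theorem st_reg_x : v.st.reg 3 = v.x := rfl
@[simp] theorem st_reg_h : v.st.reg 4 = v.h := rfl
@[simp] theorem st_reg_b : v.st.reg 5 = v.b := rfl
@[simp] theorem st_reg_c : v.st.reg 6 = v.c := rfl
@[simp] theorem st_reg_g : v.st.reg 7 = v.g := rfl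
@[simp] theorem st_reg_m : v.st.reg 8 = v.m := rfl
@[simp] theorem st_reg_y : v.st.reg 9 = v.y := rfl
@[simp] theorem st_reg_d : v.st.reg 10 = v.d := rfl
@[simp] theorem st_reg_t : v.st.reg 11 = v.t := rfl
@[simp] theorem st_reg_o : v.st.reg 12 = v.o := rfl
@[simp] theorem st_reg_n : v.st.reg 13 = v.n := rfl
@[simp] theorem st_reg_z : v.st.reg 14 = v.z := rfl
@[simp] theorem st_reg_j : v.st.reg 15 = v.j := rfl
@[simp] theorem st_arr_inp (i : ℕ) : v.st.arr 0 i = v.inp i := rfl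
@[simp] theorem st_arr_res (i : ℕ) : v.st.arr 2 i = v.res i := rfl
@[simp] theorem st_arr_flip (i : ℕ) : v.st.arr 3 i = v.flip i := rfl
@[simp] theorem st_arr_cnt (i : ℕ) : v.st.arr 4 i = v.cnt i := rfl
@[simp] theorem st_arr_gad (i : ℕ) : v.st.arr 5 i = v.gad i := rfl
@[simp] theorem st_arr_del (i : ℕ) : v.st.arr 6 i = v.del i := rfl
@[simp] theorem st_arr_head (i : ℕ) : v.st.arr 7 i = v.head i := rfl
@[simp] theorem st_arr_next (i : ℕ) : v.st.arr 8 i = v.next i := rfl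
@[simp] theorem st_arr_mark (i : ℕ) : v.st.arr 9 i = v.mark i := rfl
@[simp] theorem st_arr_start (i : ℕ) : v.st.arr 10 i = v.start i := rfl
@[simp] theorem st_arr_len (i : ℕ) : v.st.arr 11 i = v.len i := rfl
@[simp] theorem st_arr_sel (i : ℕ) : v.st.arr 12 i = v.sel i := rfl

end Reads

/-- Partial correctness of a loop by an invariant depending on the elapsed time, termination by
a measure. -/
theorem wp_loop {w : ℕ} {e : Expr} {c : Cmd} (I : ℕ → Vars → Prop) (μ : Vars → ℕ) {v : Vars}
    {Q : ℕ → State → Prop} (h0 : I 0 v)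
    (hstep : ∀ t v, I t v → e.eval w v.st ≠ 0 →
      ∀ R : ℕ → State → Prop,
        (∀ t' v', I (t + (e.cost + 1 + t')) v' → μ v' < μ v → R t' v'.st) → Wp w c v.st R)
    (hdone : ∀ t v, I t v → e.eval w v.st = 0 → Q (t + (e.cost + 1)) v.st) :
    Wp w (.loop e c) v.st Q := by
  -- Final states are kept in the form `Vars.st`, so that the invariant can speak of named variables
  -- throughout the induction on the measure.
  suffices H : ∀ N t v, μ v = N → I t v →
      ∃ t' v', Exec w (.loop e c) v.st t' (Vars.st v') ∧ Q (t + t') v'.st by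
    obtain ⟨t', v', hex, hq⟩ := H _ 0 v rfl h0
    exact ⟨t', _, hex, by simpa using hq⟩
  intro N
  induction N using Nat.strong_induction_on with
  | _ N ih =>
    intro t v hN hI
    by_cases he : e.eval w v.st = 0
    · exact ⟨_, v, .loop_done he, hdone t v hI he⟩
    · obtain ⟨t₁, s₁, hex, v₁, rfl, hI₁, hlt⟩ := hstep t v hI he
        (fun t' s' => ∃ v', s' = v'.st ∧ I (t + (e.cost + 1 + t')) v' ∧ μ v' < μ v)
        fun t' v' h₁ h₂ => ⟨v', rfl, h₁, h₂⟩
      obtain ⟨t₂, v₂, hex₂, hq⟩ := ih (μ v₁) (hN ▸ hlt) _ v₁ rfl hI₁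
      refine ⟨_, v₂, .loop_step he hex hex₂, ?_⟩
      rwa [← add_assoc, ← add_assoc] at *

/-- Words are long enough for the arithmetic with numbers of the size of `p`. -/
structure Wide (w p : ℕ) : Prop where
  big : 1000 ≤ wsize w
  lin : 100 * p ≤ wsize w
  sq : p * p ≤ wsize w

open Finset Function

/-! ### Sets of residues as unions of cyclic intervals -/

theorem add_mod_sub_mod {x d p : ℕ} (hx : x < p) (hd : d ≤ p) : ((x + d) % p + p - d) % p = x := by
  rcases lt_or_ge (x + d) p with h | h
  · rw [Nat.mod_eq_of_lt h, show x + d + p - d = x + p by omega, Nat.add_mod_right,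
      Nat.mod_eq_of_lt hx]
  · have : (x + d) % p = x + d - p := by
      rcases Nat.lt_or_ge (x + d) (p + p) with h' | h'
      · rw [Nat.mod_eq_sub_mod h, Nat.mod_eq_of_lt (by omega)]
      · omega
    rw [this, show x + d - p + p - d = x by omega, Nat.mod_eq_of_lt hx]

/-- `M y` is the time at which the residue `y` was reached, or `0`. The residue `0` is reached at
time `1`, any other residue at some time `τ` by adding `D τ` to a residue reached before.
The reached residues form the disjoint union of the `n` cyclic intervals with starting points
`U i` and lengths `L i`, and their number is `z`. -/
structure Reach (p : ℕ) (D : ℕ → ℕ) (t : ℕ) (M U L : ℕ → ℕ) (n z : ℕ) : Prop where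
  le : ∀ y < p, M y ≤ t
  one_iff : ∀ y < p, M y = 1 ↔ y = 0
  pred : ∀ y < p, 2 ≤ M y → M ((y + p - D (M y)) % p) ≠ 0 ∧ M ((y + p - D (M y)) % p) < M y
  cover : ∀ y < p, M y ≠ 0 ↔ ∃ i < n, ∃ j < L i, y = (U i + j) % p
  sum : ∑ i ∈ range n, L i = z
  card : #{y ∈ range p | M y ≠ 0} = z
  start_lt : ∀ i < n, U i < p

/-- The residue `y` can be reached at time `t` by adding `d` to a residue reached before. -/
def Fresh (p t d : ℕ) (M : ℕ → ℕ) (y : ℕ) : Prop :=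
  M y = 0 ∧ 0 < M ((y + p - d) % p) ∧ M ((y + p - d) % p) < t

namespace Reach

variable {p t n z : ℕ} {D M U L : ℕ → ℕ}

theorem z_le (h : Reach p D t M U L n z) : z ≤ p := by
  rw [← h.card]
  exact (card_filter_le _ _).trans (by simp)

theorem len_le (h : Reach p D t M U L n z) {i : ℕ} (hi : i < n) : L i ≤ z := by
  rw [← h.sum]
  exact single_le_sum (f := L) (fun _ _ => Nat.zero_le _) (mem_range.2 hi)

theorem mono (h : Reach p D t M U L n z) {t' : ℕ} (ht : t ≤ t') : Reach p D t' M U L n z :=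
  { h with le := fun y hy => (h.le y hy).trans ht }

/-- The common core of extending an interval at either end: the marks change in the same way, and
only the bookkeeping of intervals differs. Disjointness is encoded by the equality of the total
length and the number of marked residues. -/
theorem mark (h : Reach p D t M U L n z) (ht : 2 ≤ t) {y : ℕ} (hy : y < p)
    (hf : Fresh p t (D t) M y) {U' L' : ℕ → ℕ} {n' : ℕ}
    (hcover : ∀ x < p, (x = y ∨ ∃ i < n, ∃ j < L i, x = (U i + j) % p) ↔
      ∃ i < n', ∃ j < L' i, x = (U' i + j) % p)
    (hsum : ∑ i ∈ range n', L' i = z + 1) (hU : ∀ i < n', U' i < p) :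
    Reach p D t (update M y t) U' L' n' (z + 1) := by
  obtain ⟨hf0, hf1, hf2⟩ := hf
  have hp : 0 < p := by omega
  -- The predecessor is marked and `y` is not, so overwriting the mark of `y` leaves that of its
  -- predecessor alone.
  have hne : (y + p - D t) % p ≠ y := fun h => by rw [h] at hf1; omega
  refine ⟨fun x hx => ?_, fun x hx => ?_, fun x hx => ?_, fun x hx => ?_, hsum, ?_, hU⟩
  · by_cases hxy : x = y
    · simp [hxy]
    · simpa [hxy] using h.le x hx
  · by_cases hxy : x = y
    · subst hxy
      have := (h.one_iff x hx).not.1 (by omega)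
      simp only [update_self]
      omega
    · simpa [hxy] using h.one_iff x hx
  · by_cases hxy : x = y
    · subst hxy
      simp only [update_self, update_of_ne hne]
      exact fun _ => ⟨hf1.ne', hf2⟩
    · simp only [update_of_ne hxy]
      intro h2
      have := h.pred x hx h2
      have hne' : (x + p - D (M x)) % p ≠ y := fun h => this.1 (by rw [h, hf0])
      rwa [update_of_ne hne']
  · rw [← hcover x hx, ← h.cover x hx]
    by_cases hxy : x = y
    · simp [hxy]; omega
    · simp [hxy]
  · have : ({x ∈ range p | update M y t x ≠ 0} : Finset ℕ) =
        insert y {x ∈ range p | M x ≠ 0} := by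
      ext x
      by_cases hxy : x = y
      · subst hxy; simp [hy]; omega
      · simp [hxy]
    rw [this, card_insert_of_notMem (by simp [hf0]), h.card]

theorem sum_update {i : ℕ} (hi : i < n) (h : ∑ i ∈ range n, L i = z) :
    ∑ k ∈ range n, update L i (L i + 1) k = z + 1 := by
  have hi' := mem_range.2 hi
  rw [sum_update_of_mem hi', ← h, sum_eq_add_sum_sdiff_singleton_of_mem hi']
  omega

/-- Extending an interval at its end. -/
theorem extend (h : Reach p D t M U L n z) (ht : 2 ≤ t) {i : ℕ} (hi : i < n)
    (hf : Fresh p t (D t) M ((U i + L i) % p)) :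
    Reach p D t (update M ((U i + L i) % p) t) U (update L i (L i + 1)) n (z + 1) := by
  have hp : 0 < p := (Nat.zero_le _).trans_lt (h.start_lt i hi)
  refine h.mark ht (Nat.mod_lt _ hp) hf (fun x hx => ⟨?_, ?_⟩) (sum_update hi h.sum) h.start_lt
  · rintro (rfl | ⟨k, hk, j, hj, rfl⟩)
    · exact ⟨i, hi, L i, by simp, rfl⟩
    · refine ⟨k, hk, j, ?_, rfl⟩
      by_cases hki : k = i
      · subst hki; simp; omega
      · simpa [hki] using hj
  · rintro ⟨k, hk, j, hj, rfl⟩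
    by_cases hki : k = i
    · subst hki
      simp only [update_self] at hj
      rcases Nat.lt_succ_iff_lt_or_eq.1 hj with h' | rfl
      · exact Or.inr ⟨k, hk, j, h', rfl⟩
      · exact Or.inl rfl
    · rw [update_of_ne hki] at hj
      exact Or.inr ⟨k, hk, j, hj, rfl⟩

/-- Extending an interval at its beginning. -/
theorem extend_left (h : Reach p D t M U L n z) (ht : 2 ≤ t) {i : ℕ} (hi : i < n)
    (hf : Fresh p t (D t) M ((U i + p - 1) % p)) :
    Reach p D t (update M ((U i + p - 1) % p) t) (update U i ((U i + p - 1) % p))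
      (update L i (L i + 1)) n (z + 1) := by
  have hp : 0 < p := (Nat.zero_le _).trans_lt (h.start_lt i hi)
  have hsucc : ∀ j, ((U i + p - 1) % p + (j + 1)) % p = (U i + j) % p := fun j => by
    rw [Nat.mod_add_mod, show U i + p - 1 + (j + 1) = U i + j + p by omega, Nat.add_mod_right]
  refine h.mark ht (Nat.mod_lt _ hp) hf (fun x hx => ⟨?_, ?_⟩) (sum_update hi h.sum) ?_
  · rintro (rfl | ⟨k, hk, j, hj, rfl⟩)
    · exact ⟨i, hi, 0, by simp, by simp⟩
    · by_cases hki : k = i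
      · subst hki
        exact ⟨k, hk, j + 1, by simpa using hj, by simp [hsucc]⟩
      · exact ⟨k, hk, j, by simpa [hki] using hj, by simp [hki]⟩
  · rintro ⟨k, hk, j, hj, rfl⟩
    by_cases hki : k = i
    · subst hki
      simp only [update_self] at hj ⊢
      rcases j with _ | j
      · exact Or.inl (by simp)
      · exact Or.inr ⟨k, hk, j, by omega, hsucc j⟩
    · rw [update_of_ne hki] at hj ⊢
      exact Or.inr ⟨k, hk, j, hj, rfl⟩
  · intro k hk
    by_cases hki : k = i
    · subst hki; simpa using Nat.mod_lt _ hp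
    · simpa [hki] using h.start_lt k hk

/-- A new empty interval. -/
theorem append (h : Reach p D t M U L n z) {u : ℕ} (hu : u < p) :
    Reach p D t M (update U n u) (update L n 0) (n + 1) z := by
  have hne : ∀ i < n, i ≠ n := fun i hi => hi.ne
  refine { h with cover := fun y hy => ?_, sum := ?_, start_lt := fun i hi => ?_ }
  · rw [h.cover y hy]
    constructor
    · rintro ⟨i, hi, j, hj, rfl⟩
      exact ⟨i, by omega, j, by simpa [hne i hi] using hj, by simp [hne i hi]⟩
    · rintro ⟨i, hi, j, hj, rfl⟩
      by_cases hin : i = n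
      · subst hin; simp at hj
      · rw [update_of_ne hin] at hj ⊢
        exact ⟨i, by omega, j, hj, rfl⟩
  · rw [sum_range_succ, update_self, add_zero, ← h.sum]
    exact sum_congr rfl fun i hi => update_of_ne (hne i (mem_range.1 hi)) _ _
  · by_cases hin : i = n
    · subst hin; simpa using hu
    · simpa [hin] using h.start_lt i (by omega)

/-- If no reached residue can be left by adding `D t` at the end or the beginning of an interval,
or as a whole, then everything has been reached. -/
theorem eq_of_stuck [Fact p.Prime] (h : Reach p D t M U L n z) (hd0 : 0 < D t) (hdp : D t < p)
    (hlt : ∀ y < p, M y < t) (hR : ∀ i < n, ¬ Fresh p t (D t) M ((U i + L i) % p))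
    (hU : ∀ i < n, M ((U i + D t) % p) ≠ 0) : z = p := by
  have hp : 0 < p := by omega
  -- Walk along the translate of an interval by `D t`. It starts in the reached set; it could leave
  -- that set only just past the end of some interval `k`, and the residue there would be fresh.
  have hstep : ∀ i < n, ∀ j < L i, M ((U i + j + D t) % p) ≠ 0 := by
    intro i hi j
    induction j with
    | zero => intro _; simpa using hU i hi
    | succ j ih =>
      intro hj h0
      obtain ⟨k, hk, l, hl, hkl⟩ := (h.cover _ (Nat.mod_lt _ hp)).1 (ih (by omega))
      have hnext : (U i + (j + 1) + D t) % p = (U k + (l + 1)) % p := by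
        rw [show U i + (j + 1) + D t = U i + j + D t + 1 by ring, ← Nat.mod_add_mod, hkl,
          Nat.mod_add_mod, add_assoc]
      rcases Nat.lt_or_ge (l + 1) (L k) with hl' | hl'
      · exact (h.cover _ (Nat.mod_lt _ hp)).2 ⟨k, hk, l + 1, hl', hnext⟩ h0
      · have hlk : l + 1 = L k := by omega
        rw [hlk] at hnext
        refine hR k hk ⟨hnext ▸ h0, ?_⟩
        rw [← hnext, ← Nat.mod_add_mod, add_mod_sub_mod (Nat.mod_lt _ hp) hdp.le]
        exact ⟨Nat.pos_of_ne_zero ((h.cover _ (Nat.mod_lt _ hp)).2 ⟨i, hi, j + 1, hj, rfl⟩),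
          hlt _ (Nat.mod_lt _ hp)⟩
  have hclosed : ∀ y < p, M y ≠ 0 → M ((y + D t) % p) ≠ 0 := by
    intro y hy hy0
    obtain ⟨i, hi, j, hj, rfl⟩ := (h.cover y hy).1 hy0
    rw [Nat.mod_add_mod]
    exact hstep i hi j hj
  -- A set containing `0` and closed under adding `D t` contains all multiples of `D t`. These are
  -- all residues, as `D t` is invertible modulo `p`.
  have hmul : ∀ q, M (q * D t % p) ≠ 0 := by
    intro q
    induction q with
    | zero =>
      have := (h.one_iff 0 hp).2 rfl
      simp [this]
    | succ q ih =>
      have := hclosed _ (Nat.mod_lt _ hp) ih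
      rwa [Nat.mod_add_mod, ← Nat.succ_mul] at this
  rw [← h.card, filter_true_of_mem, card_range]
  intro y hy
  have hy := mem_range.1 hy
  have hunit : (D t : ZMod p) ≠ 0 := by
    rw [Ne, ZMod.natCast_eq_zero_iff]
    exact fun hdvd => absurd (Nat.le_of_dvd hd0 hdvd) (by omega)
  have := hmul ((y : ZMod p) / D t).val
  have hval : ((y : ZMod p) / D t).val * D t % p = y := by
    rw [← Nat.mod_eq_of_lt hy, ← Nat.ModEq, ← ZMod.natCast_eq_natCast_iff]
    rw [Nat.cast_mul, ZMod.natCast_val, ZMod.cast_id, div_mul_cancel₀ _ hunit]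
    simp
  rwa [hval] at this

/-- If no interval can be extended and the beginning of one is moved out of the reached set, then
the whole interval is moved out of it. -/
theorem shift_eq_zero (h : Reach p D t M U L n z) (hdp : D t < p) (hlt : ∀ y < p, M y < t)
    (hL : ∀ i < n, ¬ Fresh p t (D t) M ((U i + p - 1) % p)) {i : ℕ} (hi : i < n)
    (h0 : M ((U i + D t) % p) = 0) {j : ℕ} (hj : j < L i) : M ((U i + D t + j) % p) = 0 := by
  have hp : 0 < p := by omega
  induction j with
  | zero => simpa using h0
  | succ j ih =>
    by_contra hne
    have ih := ih (by omega)
    obtain ⟨k, hk, l, hl, hkl⟩ := (h.cover _ (Nat.mod_lt _ hp)).1 hne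
    have hprev : (U i + D t + j) % p = (U k + l + p - 1) % p := by
      have := congrArg (fun x => (x + (p - 1)) % p) hkl
      simp only [Nat.mod_add_mod] at this
      rw [show U i + D t + (j + 1) + (p - 1) = U i + D t + j + p by omega, Nat.add_mod_right] at this
      rw [this]
      congr 1
      omega
    -- The translate would enter the reached set inside some interval `k`. Entering at its beginning
    -- makes the residue before it fresh; entering later means that the preceding residue was
    -- already reached, against the induction hypothesis.
    rcases l with _ | l
    · refine hL k hk ?_
      rw [add_zero] at hprev
      rw [← hprev]
      refine ⟨ih, ?_⟩
      rw [show U i + D t + j = U i + j + D t by ring, ← Nat.mod_add_mod,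
        add_mod_sub_mod (Nat.mod_lt _ hp) hdp.le]
      exact ⟨Nat.pos_of_ne_zero ((h.cover _ (Nat.mod_lt _ hp)).2 ⟨i, hi, j, by omega, rfl⟩),
        hlt _ (Nat.mod_lt _ hp)⟩
    · rw [show U k + (l + 1) + p - 1 = U k + l + p by omega, Nat.add_mod_right] at hprev
      exact (h.cover _ (Nat.mod_lt _ hp)).2 ⟨k, hk, l, by omega, hprev⟩ ih

end Reach
/-! ### The program -/

/-- Run through `i = 0, …, p - 2`. -/
def forEach (body : Cmd) : Cmd :=
  .seq (set_i 0) (.loop ((ri + 1).lt rp) (.seq body (set_i (ri + 1))))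

/-- Replace `x` by `p - x` if that is smaller. -/
def halfCmd : Cmd := .branch (rp.lt (rx + rx)) (set_x (rp - rx)) .skip

/-- Count the elements of each class `{x, -x}`; put the largest count into `h` and the
representative of its class into `b`. -/
def countCmd : Cmd := forEach <|
  .seq (set_x (ainp ri)) <|
  .seq halfCmd <|
  .seq (put_cnt rx (acnt rx + 1)) <|
  .branch (rh.lt (acnt rx)) (.seq (set_h (acnt rx)) (set_b rx)) .skip

/-- Put the inverse of `b` modulo `p` into `c`. -/
def inverseCmd : Cmd :=
  .loop (((rc * rb) % rp).eq 1 |>.eq 0) (set_c (rc + 1))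

/-- Multiply everything by `c` and change signs such that all elements are at most `p / 2`. -/
def scaleCmd : Cmd := .seq (set_k ((rc * rk) % rp)) <| forEach <|
  .seq (set_x ((rc * ainp ri) % rp)) <|
  .seq (.branch (rp.lt (rx + rx))
    (.seq (set_x (rp - rx)) (.seq (put_flip ri 1) (set_k ((rk + rx) % rp)))) .skip) <|
  put_res ri rx

/-- Make a new step out of the element with index `i`. -/
def singleCmd : Cmd :=
  .seq (put_gad ri rg) (.seq (put_del rg (ares ri)) (set_g (rg + 1)))

/-- Make a step out of each element `1`. -/
def onesCmd : Cmd := .seq (set_g 2) <| forEach <|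
  .branch ((ares ri).eq 1) singleCmd .skip

/-- Make a new step, the difference, out of the elements with indices `i` and `j - 1`. -/
def pairCmd : Cmd :=
  .seq (put_head rb (anext (rj - 1))) <|
  .seq (put_gad ri rg) <|
  .seq (put_gad (rj - 1) rg) <|
  .seq (set_y (ares (rj - 1))) <|
  .seq (.branch (rx.lt ry)
    (.seq (put_del rg (ry - rx)) (.seq (put_flip ri (1 - aflip ri)) (set_k ((rk + rp - rx) % rp))))
    (.seq (put_del rg (rx - ry))
      (.seq (put_flip (rj - 1) (1 - aflip (rj - 1))) (set_k ((rk + rp - ry) % rp))))) <|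
  .seq (set_g (rg + 1)) (set_m (rm + 1))

/-- Make steps out of pairs of different elements with the same quotient by `h`, waiting elements
being kept in one stack for each quotient, until `h + m` is large enough. -/
def pairsCmd : Cmd := forEach <|
  .branch ((Expr.lt 1 (ares ri)) * (((rh + rm) * 8).lt rp))
    (.seq (set_x (ares ri)) <|
      .seq (set_b (rx / rh)) <|
      .seq (set_j (ahead rb)) <|
      .branch (rj.eq 0 + (ares (rj - 1)).eq rx)
        (.seq (put_next ri (ahead rb)) (put_head rb (ri + 1)))
        pairCmd)
    .skip

/-- Make a step out of each remaining element. -/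
def restCmd : Cmd := forEach <| .branch ((agad ri).eq 0) singleCmd .skip

/-- The test whether `y` can be reached at time `t` by adding `d` to an earlier residue. -/
def freshTest (y : Expr) : Expr :=
  ((amark y).eq 0) * ((Expr.lt 0 (amark ((y + rp - rd) % rp))) *
    ((amark ((y + rp - rd) % rp)).lt rt))

/-- Extend the interval with number `i` at its end as far as possible. -/
def extendCmd : Cmd :=
  .seq (set_y ((astart ri + alen ri) % rp)) <|
  .loop (freshTest ry) <|
    .seq (put_mark ry rt) <| .seq (put_len ri (alen ri + 1)) <| .seq (set_z (rz + 1)) <|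
    set_y ((astart ri + alen ri) % rp)

/-- Extend all intervals at their ends. -/
def extendAllCmd : Cmd :=
  .seq (set_i 0) <| .loop (ri.lt rn) <| .seq extendCmd (set_i (ri + 1))

/-- Unless the number of reached residues has increased, extend one interval at its beginning. -/
def extendLeftCmd : Cmd :=
  .seq (set_i 0) <| .loop ((ri.lt rn) * (rz.eq ro)) <|
  .seq (set_y ((astart ri + rp - 1) % rp)) <|
  .seq (.branch (freshTest ry)
    (.seq (put_mark ry rt) <| .seq (put_start ri ry) <| .seq (put_len ri (alen ri + 1)) <|
      set_z (rz + 1)) .skip) <|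
  set_i (ri + 1)

/-- Unless the number of reached residues has increased, create a new interval. -/
def newIntervalCmd : Cmd :=
  .seq (set_i 0) <|
  .seq (.loop ((ri.lt rn) * ((rz.eq ro) * Expr.lt 0 (amark ((astart ri + rd) % rp))))
    (set_i (ri + 1))) <|
  .branch ((ri.lt rn) * (rz.eq ro))
    (.seq (put_start rn ((astart ri + rd) % rp)) <| .seq (put_len rn 0) <|
      .seq (set_i rn) <| .seq extendCmd <| set_n (rn + 1))
    .skip

/-- Use the step `t`. -/
def stepCmd : Cmd :=
  .seq (set_d (adel rt)) <| .seq (set_o rz) <|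
  .seq extendAllCmd <| .seq extendLeftCmd newIntervalCmd

/-- Use all steps. -/
def growCmd : Cmd :=
  .seq (put_mark 0 1) <| .seq (put_len 0 1) <| .seq (set_n 1) <| .seq (set_z 1) <|
  .seq (set_t 2) <| .loop (rt.lt rg) <| .seq stepCmd <| set_t (rt + 1)

/-- Select the steps leading to `k`. -/
def selectCmd : Cmd :=
  .seq (set_y rk) <| .loop (Expr.lt 0 ry) <|
  .seq (set_t (amark ry)) <| .seq (put_sel rt 1) <| set_y ((ry + rp - adel rt) % rp)

/-- Write the output. -/
def outputCmd : Cmd := forEach <| put_out ri ((aflip ri + asel (agad ri)) % 2)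

/-- The whole program. -/
def subsetSumCmd : Cmd :=
  .seq countCmd <| .seq inverseCmd <| .seq scaleCmd <| .seq onesCmd <| .seq pairsCmd <|
  .seq restCmd <| .seq growCmd <| .seq selectCmd outputCmd

/-! ### Enlarging the reached set by one step -/

/-- Some more residues have been reached, at time `t`. -/
def Grow (t : ℕ) (M M' : ℕ → ℕ) : Prop := ∀ x, M' x = M x ∨ (M x = 0 ∧ M' x = t)

theorem Grow.refl (t : ℕ) (M : ℕ → ℕ) : Grow t M M := fun _ => Or.inl rfl

theorem Grow.trans {t : ℕ} {M M' M'' : ℕ → ℕ} (h : Grow t M M') (h' : Grow t M' M'') :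
    Grow t M M'' := fun x => by
  rcases h x with h1 | h1 <;> rcases h' x with h2 | h2 <;> omega

theorem Grow.update {t : ℕ} {M : ℕ → ℕ} {y : ℕ} (hy : M y = 0) : Grow t M (update M y t) :=
  fun x => by
    by_cases h : x = y
    · subst h; simp [hy]
    · simp [h]

/-- Freshness needs a predecessor with a mark below `t`, and new marks equal `t`. So a residue never
becomes fresh during step `t`, and one pass over the intervals suffices. -/
theorem Grow.not_fresh {p t d y : ℕ} {M M' : ℕ → ℕ} (h : Grow t M M') (hf : ¬ Fresh p t d M y) :
    ¬ Fresh p t d M' y := by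
  rintro ⟨h0, h1, h2⟩
  refine hf ⟨?_, ?_⟩
  · rcases h y with h3 | h3 <;> omega
  · rcases h ((y + p - d) % p) with h3 | h3 <;> omega

theorem eval_freshTest {w : ℕ} {v : Vars} (hW : Wide w v.p) {e : Expr} (he : e.eval w v.st < v.p) :
    (freshTest e).eval w v.st ≠ 0 ↔ Fresh v.p v.t v.d v.mark (e.eval w v.st) := by
  have := hW.big
  have := hW.lin
  simp only [freshTest, eval_mul, eval_eq, eval_lt, eval_zero, eval_load, eval_reg, eval_mod,
    eval_sub, eval_add, st_arr_mark, st_reg_p, st_reg_d, st_reg_t]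
  rw [Nat.mod_eq_of_lt (by omega : e.eval w v.st + v.p < _)]
  simp only [ind_mod_wsize (by omega : 2 ≤ wsize w), ind_mul]
  simp [Fresh]

theorem fresh_of_eval {w : ℕ} {v : Vars} (h : (freshTest ry).eval w v.st ≠ 0) (hW : Wide w v.p)
    (hy : v.y < v.p) : Fresh v.p v.t v.d v.mark v.y :=
  (eval_freshTest (e := ry) hW hy).1 h

theorem not_fresh_of_eval {w : ℕ} {v : Vars} (h : (freshTest ry).eval w v.st = 0)
    (hW : Wide w v.p) (hy : v.y < v.p) : ¬ Fresh v.p v.t v.d v.mark v.y :=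
  mt (eval_freshTest (e := ry) hW hy).2 (not_not.2 h)

/-- The cost is charged to the `e` new residues, up to a constant; the total number of reached
residues, at most `p`, bounds the loop. -/
theorem wp_extendCmd {w n : ℕ} {v : Vars} {Q : ℕ → State → Prop} (hW : Wide w v.p)
    (hR : Reach v.p v.del v.t v.mark v.start v.len n v.z) (hi : v.i < n) (ht : 2 ≤ v.t)
    (hd : v.d = v.del v.t)
    (hQ : ∀ s y e M, s ≤ 100 * e + 100 → Grow v.t v.mark M →
      Reach v.p v.del v.t M v.start (update v.len v.i (v.len v.i + e)) n (v.z + e) →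
      ¬ Fresh v.p v.t v.d M ((v.start v.i + (v.len v.i + e)) % v.p) →
      Q s {v with y := y, mark := M, len := update v.len v.i (v.len v.i + e), z := v.z + e}.st) :
    Wp w extendCmd v.st Q := by
  have := hW.big
  have := hW.lin
  have hp : 0 < v.p := (Nat.zero_le _).trans_lt (hR.start_lt _ hi)
  have := hR.start_lt _ hi
  have := (hR.len_le hi).trans hR.z_le
  rw [extendCmd, wp_seq, wp_assign, Vars.st_setReg_y]
  simp (disch := omega) only [eval_add, eval_load, eval_reg, st_arr_start, st_arr_len, st_reg_i,
    Nat.mod_eq_of_lt, eval_mod, st_reg_p]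
  refine wp_loop (fun s u => ∃ e M, s ≤ 100 * e ∧ Grow v.t v.mark M ∧
      Reach v.p v.del v.t M v.start (update v.len v.i (v.len v.i + e)) n (v.z + e) ∧
      u = {v with y := (v.start v.i + (v.len v.i + e)) % v.p, mark := M,
                  len := update v.len v.i (v.len v.i + e), z := v.z + e})
    (fun u => u.p - u.z) ⟨0, v.mark, by simp, Grow.refl _ _, by simpa using hR, by simp⟩ ?_ ?_
  · rintro s u ⟨e, M, hs, hg, hr, rfl⟩ htest R hQR
    have htest := fresh_of_eval htest hW (Nat.mod_lt _ hp)
    dsimp only at htest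
    have hlen := (hr.len_le hi).trans hr.z_le
    have hr' := hr.extend ht hi (by simpa [hd] using htest)
    have hz := hr'.z_le
    simp only [update_self] at hlen
    simp (disch := omega) [Nat.mod_eq_of_lt]
    refine hQR _ _ ⟨e + 1, update M ((v.start v.i + (v.len v.i + e)) % v.p) v.t, ?_, ?_, ?_, ?_⟩ ?_
    · simp [freshTest]; omega
    · exact hg.trans (Grow.update htest.1)
    · simpa [add_assoc] using hr'
    · simp [add_assoc]
    · simp; omega
  · rintro s u ⟨e, M, hs, hg, hr, rfl⟩ htest
    exact hQ _ _ e M (by simp [freshTest]; omega) hg hr (not_fresh_of_eval htest hW (Nat.mod_lt _ hp))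

/-- Marks are never removed. If the number of reached residues has not changed, nothing has, so the
marks are still those from before step `t`. -/
theorem Grow.eq_of_card {p t n z n' : ℕ} {D M U L M' U' L' : ℕ → ℕ} (h : Grow t M M') (ht : 0 < t)
    (hR : Reach p D t M U L n z) (hR' : Reach p D t M' U' L' n' z) {y : ℕ} (hy : y < p) :
    M' y = M y := by
  have hsub : ({x ∈ range p | M x ≠ 0} : Finset ℕ) ⊆ {x ∈ range p | M' x ≠ 0} := by
    intro x
    simp only [mem_filter]
    rintro ⟨hx, h0⟩
    rcases h x with h1 | h1 <;> exact ⟨hx, by omega⟩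
  have heq := eq_of_subset_of_card_le hsub (by rw [hR.card, hR'.card])
  rcases h y with h1 | ⟨h1, h2⟩
  · exact h1
  · have : y ∈ ({x ∈ range p | M' x ≠ 0} : Finset ℕ) := by simp [hy]; omega
    rw [← heq] at this
    simp [h1] at this

theorem wp_extendAllCmd {w : ℕ} {v : Vars} {Q : ℕ → State → Prop} (hW : Wide w v.p)
    (hR : Reach v.p v.del v.t v.mark v.start v.len v.n v.z) (ht : 2 ≤ v.t) (hn : v.n ≤ v.p)
    (hd : v.d = v.del v.t)
    (hQ : ∀ s i y e M L, s ≤ 200 * v.n + 100 * e + 100 → Grow v.t v.mark M →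
      Reach v.p v.del v.t M v.start L v.n (v.z + e) → (∀ i, v.len i ≤ L i) →
      (∀ i < v.n, ¬ Fresh v.p v.t v.d M ((v.start i + L i) % v.p)) →
      Q s {v with i := i, y := y, mark := M, len := L, z := v.z + e}.st) :
    Wp w extendAllCmd v.st Q := by
  have := hW.big
  have := hW.lin
  rw [extendAllCmd, wp_seq, wp_assign, Vars.st_setReg_i]
  refine wp_loop (fun s u => ∃ i y e M L, s ≤ 200 * i + 100 * e ∧ i ≤ v.n ∧ Grow v.t v.mark M ∧
      Reach v.p v.del v.t M v.start L v.n (v.z + e) ∧ (∀ i, v.len i ≤ L i) ∧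
      (∀ k < i, ¬ Fresh v.p v.t v.d M ((v.start k + L k) % v.p)) ∧
      u = {v with i := i, y := y, mark := M, len := L, z := v.z + e})
    (fun u => u.n - u.i) ⟨0, v.y, 0, v.mark, v.len, by simp, by simp, Grow.refl _ _,
      by simpa using hR, by simp, by simp, by simp⟩ ?_ ?_
  · rintro s u ⟨i, y, e, M, L, hs, hin, hg, hr, hl, hf, rfl⟩ htest R hQR
    rw [eval_lt, ind_mod_wsize (by omega)] at htest
    simp at htest
    rw [wp_seq]
    refine wp_extendCmd hW hr htest ht hd ?_
    rintro s' y' e' M' hs' hg' hr' hf'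
    dsimp only at hs' hg' hr' hf'
    simp (disch := omega) [Nat.mod_eq_of_lt]
    refine hQR _ _ ⟨i + 1, y', e + e', M', update L i (L i + e'), ?_, htest, hg.trans hg', ?_, ?_,
      ?_, ?_⟩ ?_
    · simp; omega
    · simpa [add_assoc] using hr'
    · intro k
      by_cases hk : k = i
      · subst hk; have := hl k; simp; omega
      · simpa [hk] using hl k
    · intro k hk
      by_cases hki : k = i
      · subst hki; simpa using hf'
      · simpa [hki] using hg'.not_fresh (hf k (by omega))
    · simp [add_assoc]
    · simp; omega
  · rintro s u ⟨i, y, e, M, L, hs, hin, hg, hr, hl, hf, rfl⟩ htest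
    rw [eval_lt, ind_mod_wsize (by omega)] at htest
    simp at htest
    obtain rfl : i = v.n := by omega
    exact hQ _ _ _ _ _ _ (by simp; omega) hg hr hl hf

/-- Two outcomes: no change, with no interval extendable to the left if nothing had grown before; or
exactly one residue added, after which the loop test `z = o` fails. One residue is enough, as only
progress by `1` is required here. -/
theorem wp_extendLeftCmd {w : ℕ} {v : Vars} {Q : ℕ → State → Prop} (hW : Wide w v.p)
    (hR : Reach v.p v.del v.t v.mark v.start v.len v.n v.z) (hn : v.n ≤ v.p)
    (hQ0 : ∀ s i y, s ≤ 200 * v.n + 100 →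
      (v.z = v.o → ∀ i < v.n, ¬ Fresh v.p v.t v.d v.mark ((v.start i + v.p - 1) % v.p)) →
      Q s {v with i := i, y := y}.st)
    (hQ1 : ∀ s k i y, s ≤ 200 * v.n + 100 → v.z = v.o → i < v.n →
      y = (v.start i + v.p - 1) % v.p → Fresh v.p v.t v.d v.mark y →
      Q s {v with i := k, y := y, mark := update v.mark y v.t, start := update v.start i y,
                  len := update v.len i (v.len i + 1), z := v.z + 1}.st) :
    Wp w extendLeftCmd v.st Q := by
  have := hW.big
  have := hW.lin
  have := hR.z_le
  rw [extendLeftCmd, wp_seq, wp_assign, Vars.st_setReg_i]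
  refine wp_loop (fun s u => ∃ i y, s ≤ 200 * i ∧ i ≤ v.n ∧
      ((v.z = v.o → ∀ k < i, ¬ Fresh v.p v.t v.d v.mark ((v.start k + v.p - 1) % v.p)) ∧
      u = {v with i := i, y := y} ∨ v.z = v.o ∧ ∃ k < v.n,
      y = (v.start k + v.p - 1) % v.p ∧ Fresh v.p v.t v.d v.mark y ∧
      u = {v with i := i, y := y, mark := update v.mark y v.t, start := update v.start k y,
                  len := update v.len k (v.len k + 1), z := v.z + 1}))
    (fun u => u.n - u.i) ⟨0, v.y, by simp, by simp, by simp⟩ ?_ ?_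
  · rintro s u ⟨i, y, hs, hin, h | h⟩ htest R hQR
    · obtain ⟨hf, rfl⟩ := h
      rw [eval_mul, eval_lt, eval_eq, ind_mod_wsize (by omega), ind_mod_wsize (by omega), ind_mul,
        ind_mod_wsize (by omega)] at htest
      simp at htest
      have := hR.start_lt _ htest.1
      have hlt : (v.start i + v.p - 1) % v.p < v.p := Nat.mod_lt _ (by omega)
      have hlen := (hR.len_le htest.1).trans hR.z_le
      simp (disch := omega) only [wp_seq, wp_assign, wp_branch, wp_skip, wp_store, eval_add,
        eval_mod, eval_load, eval_sub, eval_one, eval_reg, st_arr_start, st_reg_i, st_reg_p,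
        Nat.mod_eq_of_lt, Vars.st_setReg_y, Vars.st_setArr_mark, Vars.st_setArr_start,
        Vars.st_setArr_len, Vars.st_setReg_z, Vars.st_setReg_i, st_reg_y, st_reg_t, st_arr_len,
        st_reg_z]
      refine ⟨fun h => ?_, fun h => ?_⟩
      · have h := fresh_of_eval h hW hlt
        refine hQR _ _ ⟨i + 1, _, ?_, htest.1, Or.inr ⟨htest.2, i, htest.1, rfl, h, rfl⟩⟩ ?_
        · simp [freshTest]; omega
        · simp; omega
      · have h := not_fresh_of_eval h hW hlt
        refine hQR _ _ ⟨i + 1, _, ?_, htest.1, Or.inl ⟨fun ho k hk => ?_, rfl⟩⟩ ?_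
        · simp [freshTest]; omega
        · rcases Nat.lt_succ_iff_lt_or_eq.1 hk with hk | rfl
          · exact hf ho k hk
          · exact h
        · simp; omega
    · obtain ⟨ho, k, hk, hy, hf, rfl⟩ := h
      -- A residue has been added, so `z` exceeds `o` and the test cannot have succeeded.
      exfalso
      rw [eval_mul, eval_lt, eval_eq, ind_mod_wsize (by omega), ind_mod_wsize (by omega), ind_mul,
        ind_mod_wsize (by omega)] at htest
      simp at htest
      omega
  · rintro s u ⟨i, y, hs, hin, h | h⟩ htest
    · obtain ⟨hf, rfl⟩ := h
      rw [eval_mul, eval_lt, eval_eq, ind_mod_wsize (by omega), ind_mod_wsize (by omega), ind_mul,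
        ind_mod_wsize (by omega)] at htest
      simp at htest
      refine hQ0 _ _ _ (by simp; omega) fun ho k hk => hf ho k ?_
      by_contra hki
      exact htest (by omega) ho
    · obtain ⟨ho, k, hk, hy, hf, rfl⟩ := h
      exact hQ1 _ _ _ _ (by simp; omega) ho hk hy hf

theorem wp_newIntervalCmd {w : ℕ} {v : Vars} {Q : ℕ → State → Prop} (hW : Wide w v.p)
    (hR : Reach v.p v.del v.t v.mark v.start v.len v.n v.z) (hn : v.n ≤ v.p) (ht : 2 ≤ v.t)
    (hd : v.d = v.del v.t) (hdp : v.d < v.p)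
    (hQ0 : ∀ s i, s ≤ 200 * v.n + 300 →
      (v.z = v.o → ∀ i < v.n, v.mark ((v.start i + v.d) % v.p) ≠ 0) →
      Q s {v with i := i}.st)
    (hQ1 : ∀ s i y e M, s ≤ 200 * v.n + 100 * e + 300 → v.z = v.o → i < v.n →
      v.mark ((v.start i + v.d) % v.p) = 0 → Grow v.t v.mark M →
      Reach v.p v.del v.t M (update v.start v.n ((v.start i + v.d) % v.p)) (update v.len v.n e)
        (v.n + 1) (v.z + e) →
      ¬ Fresh v.p v.t v.d M ((v.start i + v.d + e) % v.p) →
      Q s {v with i := v.n, y := y, mark := M, n := v.n + 1, z := v.z + e,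
                  start := update v.start v.n ((v.start i + v.d) % v.p),
                  len := update v.len v.n e}.st) :
    Wp w newIntervalCmd v.st Q := by
  have := hW.big
  have := hW.lin
  have := hR.z_le
  rw [newIntervalCmd, wp_seq, wp_assign, Vars.st_setReg_i, wp_seq]
  refine wp_loop (fun s u => ∃ i, s ≤ 100 * i ∧ i ≤ v.n ∧
      (v.z = v.o → ∀ k < i, v.mark ((v.start k + v.d) % v.p) ≠ 0) ∧ u = {v with i := i})
    (fun u => u.n - u.i) ⟨0, by simp, by simp, by simp, by simp⟩ ?_ ?_
  · rintro s u ⟨i, hs, hin, hf, rfl⟩ htest R hQR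
    have hi : i < v.n := by
      by_contra hcon
      rw [eval_mul, eval_lt, eval_reg, eval_reg, st_reg_i, st_reg_n, ind_eq_zero.2 hcon] at htest
      simp at htest
    have := hR.start_lt _ hi
    simp (disch := omega) only [eval_mul, eval_lt, eval_eq, ind_mod_wsize, ind_mul,
      eval_load, eval_mod, eval_add, eval_reg, st_arr_start, st_arr_mark, st_reg_i, st_reg_p,
      st_reg_d, Nat.mod_eq_of_lt, eval_zero] at htest
    simp at htest
    simp (disch := omega) [Nat.mod_eq_of_lt]
    refine hQR _ _ ⟨i + 1, ?_, hi, fun ho k hk => ?_, rfl⟩ ?_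
    · simp; omega
    · rcases Nat.lt_succ_iff_lt_or_eq.1 hk with hk | rfl
      · exact hf ho k hk
      · omega
    · simp; omega
  · rintro s u ⟨i, hs, hin, hf, rfl⟩ htest
    simp (disch := omega) only [wp_branch, eval_mul, eval_lt, eval_eq, ind_mod_wsize,
      ind_mul, eval_reg, wp_skip]
    refine ⟨fun h => ?_, fun h => ?_⟩
    · simp at h
      obtain ⟨hi, ho⟩ := h
      have := hR.start_lt _ hi
      have hlt : (v.start i + v.d) % v.p < v.p := Nat.mod_lt _ (by omega)
      simp (disch := omega) only [eval_mul, eval_lt, eval_eq, ind_mod_wsize, ind_mul,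
        eval_load, eval_mod, eval_add, eval_reg, st_arr_start, st_arr_mark, st_reg_i, st_reg_p,
        st_reg_d, Nat.mod_eq_of_lt, eval_zero] at htest
      simp [hi, ho] at htest
      simp (disch := omega) only [wp_seq, wp_assign, wp_store, eval_add,
        eval_mod, eval_load, eval_zero, eval_reg, st_arr_start, st_reg_i, st_reg_p, st_reg_d,
        Nat.mod_eq_of_lt, Vars.st_setArr_start, st_reg_n,
        Vars.st_setArr_len, Vars.st_setReg_i]
      -- The new interval begins empty, so that filling it is an ordinary extension at its end.
      have hr := hR.append hlt
      refine wp_extendCmd hW hr (Nat.lt_succ_self _) ht hd ?_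
      rintro s' y e M hs' hg hr' hf'
      dsimp only at hs' hg hr' hf'
      simp only [update_self, zero_add, update_idem, Nat.mod_add_mod] at hr' hf'
      simp (disch := omega) [Nat.mod_eq_of_lt]
      exact hQ1 _ i _ _ _ (by omega) ho hi htest hg hr' hf'
    · simp at h
      refine hQ0 _ _ (by simp; omega) fun ho k hk => hf ho k ?_
      by_contra hki
      exact h (by omega) ho

/-! ### Growth of a single interval starting at zero -/

namespace Reach

variable {p t n z : ℕ} {D M U L : ℕ → ℕ}

theorem ne_zero_of_full (h : Reach p D t M U L n p) {y : ℕ} (hy : y < p) : M y ≠ 0 := by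
  have := eq_of_subset_of_card_le (filter_subset (fun y => M y ≠ 0) (range p))
    (by rw [h.card, card_range])
  exact (filter_eq_self.1 this) y (mem_range.2 hy)

theorem single_iff (h : Reach p D t M U L 1 z) (hU : U 0 = 0) {y : ℕ} (hy : y < p) :
    M y ≠ 0 ↔ y < z := by
  have hz := h.z_le
  have hs : L 0 = z := by simpa using h.sum
  rw [h.cover y hy]
  constructor
  · rintro ⟨i, hi, j, hj, rfl⟩
    obtain rfl : i = 0 := by omega
    rw [hU, zero_add, Nat.mod_eq_of_lt (by omega)]
    omega
  · intro hyz
    exact ⟨0, one_pos, y, by omega, by rw [hU, zero_add, Nat.mod_eq_of_lt hy]⟩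

/-- A single interval grows as far as possible. -/
theorem single_stuck {M' L' : ℕ → ℕ} {e : ℕ} (h : Reach p D t M U L 1 z) (hU : U 0 = 0)
    (hlt : ∀ y < p, M y < t) (h' : Reach p D t M' U L' 1 (z + e)) (hg : Grow t M M')
    (hd : D t ≤ z) (hf : ¬ Fresh p t (D t) M' ((U 0 + L' 0) % p)) : z + e = p ∨ D t ≤ e := by
  by_contra! hcon
  have hz := h'.z_le
  have hs : L' 0 = z + e := by simpa using h'.sum
  have hlt' : z + e < p := by omega
  rw [hU, zero_add, hs, Nat.mod_eq_of_lt hlt'] at hf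
  -- If `e < D t ≤ z`, the predecessor `z + e - D t` of the residue past the end lies in the old
  -- interval `[0, z)`, so that residue is fresh.
  have hsub : (z + e + p - D t) % p = z + e - D t := by
    rw [show z + e + p - D t = z + e - D t + p by omega, Nat.add_mod_right,
      Nat.mod_eq_of_lt (by omega)]
  refine hf ⟨?_, ?_⟩
  · by_contra h0
    exact absurd ((h'.single_iff hU hlt').1 h0) (lt_irrefl _)
  · rw [hsub]
    have h1 := (h.single_iff hU (y := z + e - D t) (by omega)).2 (by omega)
    have h2 := hlt (z + e - D t) (by omega)
    rcases hg (z + e - D t) with h3 | h3 <;> omega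

/-- A single interval can not be extended by a step exceeding its length. -/
theorem single_not_extend {M' L' : ℕ → ℕ} {e : ℕ} (h : Reach p D t M U L 1 z) (hU : U 0 = 0)
    (h' : Reach p D t M' U L' 1 (z + e)) (hg : Grow t M M') (ht : 2 ≤ t)
    (hd : z < D t) (hdp : D t ≤ p) : e = 0 := by
  by_contra he
  have hz := h'.z_le
  have hzp : z < p := by omega
  have h1 := (h'.single_iff hU hzp).2 (by omega)
  have h0 : M z = 0 := by
    by_contra h0
    exact absurd ((h.single_iff hU hzp).1 h0) (lt_irrefl _)
  have h2 : M' z = t := by rcases hg z with h3 | h3 <;> omega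
  -- If the interval has grown, then `z` itself was reached at time `t` from `z + p - D t`. That
  -- residue would have to lie in `[0, z)`, contrary to `D t ≤ p`.
  have h3 := h'.pred z hzp (by omega)
  rw [h2, Nat.mod_eq_of_lt (by omega)] at h3
  have h4 : M (z + p - D t) ≠ 0 := by
    rcases hg (z + p - D t) with h5 | h5 <;> omega
  have h5 := (h.single_iff hU (y := z + p - D t) (by omega)).1 h4
  omega

end Reach

/-- Besides progress by at least one residue unless all are reached, this records that no interval
becomes shorter than the shortest old one, and how a single interval starting at `0` behaves: steps
up to its length prolong it, longer steps up to `p / 2` at least double the reached set. -/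
theorem wp_stepCmd {w : ℕ} {v : Vars} [Fact v.p.Prime] {Q : ℕ → State → Prop} (hW : Wide w v.p)
    (hR : Reach v.p v.del v.t v.mark v.start v.len v.n v.z) (hlt : ∀ y < v.p, v.mark y < v.t)
    (hlen0 : ∀ i < v.n, 0 < v.len i) (hn : v.n ≤ v.p) (ht : 2 ≤ v.t) (hd0 : 0 < v.del v.t) (hdp : v.del v.t < v.p)
    (hQ : ∀ s d o i y M U L n e, s ≤ 600 * v.n + 100 * e + 1000 →
      Reach v.p v.del v.t M U L n (v.z + e) → (v.z + e = v.p ∨ 0 < e) →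
      n ≤ v.n + 1 → (∀ i < n, ∃ k < v.n, v.len k ≤ L i) →
      (v.n = 1 → v.start 0 = 0 → v.del v.t ≤ v.z →
        n = 1 ∧ U 0 = 0 ∧ (v.z + e = v.p ∨ v.del v.t ≤ e)) →
      (v.n = 1 → v.start 0 = 0 → v.z < v.del v.t → 2 * v.del v.t ≤ v.p → v.z ≤ e) →
      Q s {v with d := d, o := o, i := i, y := y, mark := M, start := U, len := L, n := n,
                  z := v.z + e}.st) :
    Wp w stepCmd v.st Q := by
  have := hW.big
  have := hW.lin
  simp only [stepCmd, wp_seq, wp_assign, Vars.st_setReg_d, Vars.st_setReg_o, eval_load, eval_reg,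
    st_reg_t, st_arr_del, st_reg_z]
  refine wp_extendAllCmd hW hR ht hn rfl ?_
  intro s₁ i₁ y₁ e₁ M₁ L₁ hs₁ hg₁ hR₁ hl₁ hf₁
  dsimp only at hs₁ hg₁ hR₁ hl₁ hf₁
  have heq : e₁ = 0 → ∀ y < v.p, M₁ y = v.mark y := by
    rintro rfl y hy
    exact hg₁.eq_of_card (by omega) hR hR₁ hy
  have hlt₁ : e₁ = 0 → ∀ y < v.p, M₁ y < v.t := fun h y hy => by
    rw [heq h y hy]; exact hlt y hy
  have hsmall : v.n = 1 → v.start 0 = 0 → v.del v.t ≤ v.z →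
      v.z + e₁ = v.p ∨ v.del v.t ≤ e₁ := by
    intro h1 hU hd
    rw [h1] at hR hR₁
    exact hR.single_stuck hU hlt hR₁ hg₁ hd (hf₁ 0 (by omega))
  have hbig : v.n = 1 → v.start 0 = 0 → v.z < v.del v.t → e₁ = 0 := by
    intro h1 hU hd
    rw [h1] at hR hR₁
    exact hR.single_not_extend hU hR₁ hg₁ ht hd hdp.le
  refine wp_extendLeftCmd hW hR₁ hn ?_ ?_
  · intro s₂ i₂ y₂ hs₂ hf₂
    dsimp only at hs₂ hf₂
    refine wp_newIntervalCmd hW hR₁ hn ht rfl hdp ?_ ?_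
    · intro s₃ i₃ hs₃ hU
      dsimp only at hs₃ hU
      have hprog : v.z + e₁ = v.p ∨ 0 < e₁ := by
        rcases Nat.eq_zero_or_pos e₁ with h0 | h0
        -- Nothing was added on the right, and all translated beginnings are reached, so the reached
        -- set is closed under the step.
        · exact Or.inl (hR₁.eq_of_stuck hd0 hdp (hlt₁ h0) hf₁ (hU (by omega)))
        · exact Or.inr h0
      refine hQ _ _ _ _ _ _ _ _ _ _ ?_ hR₁ hprog (Nat.le_succ _) (fun i hi => ⟨i, hi, hl₁ i⟩)
        (fun h1 hU hd => ⟨h1, hU, hsmall h1 hU hd⟩) (fun h1 hU hd h2d => ?_)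
      · simp; omega
      · have := hbig h1 hU hd
        omega
    · intro s₃ i₃ y₃ e₃ M₃ hs₃ ho hi hM hg₃ hR₃ hf₃
      dsimp only at hs₃ ho hi hM hg₃ hR₃ hf₃
      obtain rfl : e₁ = 0 := by omega
      -- The entire translate of interval `i₃` avoids the old set, by `shift_eq_zero`. Had the new
      -- interval stopped inside it, the next residue would be unmarked with a predecessor in
      -- interval `i₃`, hence fresh.
      have hlen : L₁ i₃ ≤ e₃ := by
        by_contra! hcon
        have hp : 0 < v.p := by omega
        have h0 := hR₁.shift_eq_zero hdp (hlt₁ rfl) (hf₂ rfl) hi hM hcon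
        have hle := (hR₃.len_le (Nat.lt_succ_self _)).trans hR₃.z_le
        have hle' := (hR₁.len_le hi).trans hR₁.z_le
        rw [update_self] at hle
        refine hf₃ ⟨?_, ?_⟩
        · by_contra hne
          obtain ⟨k, hk, j, hj, hkj⟩ := (hR₃.cover _ (Nat.mod_lt _ hp)).1 hne
          by_cases hkn : k = v.n
          · subst hkn
            simp only [update_self] at hj hkj
            rw [Nat.mod_add_mod] at hkj
            have := Nat.ModEq.add_left_cancel' _ (show _ ≡ _ [MOD v.p] from hkj)
            have := this.eq_of_lt_of_lt (by omega) (by omega)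
            omega
          · rw [update_of_ne hkn] at hj hkj
            exact (hR₁.cover _ (Nat.mod_lt _ hp)).2 ⟨k, by omega, j, hj, hkj⟩ h0
        · rw [show v.start i₃ + v.del v.t + e₃ = v.start i₃ + e₃ + v.del v.t by ring,
            ← Nat.mod_add_mod, add_mod_sub_mod (Nat.mod_lt _ hp) hdp.le]
          have h1 := (hR₁.cover _ (Nat.mod_lt _ hp)).2 ⟨i₃, hi, e₃, hcon, rfl⟩
          have h2 := hlt₁ rfl ((v.start i₃ + e₃) % v.p) (Nat.mod_lt _ hp)
          rcases hg₃ ((v.start i₃ + e₃) % v.p) with h3 | h3 <;> omega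
      have hnf : ¬ v.z = v.p := fun hz => by
        rw [add_zero, hz] at hR₁
        exact hR₁.ne_zero_of_full (Nat.mod_lt _ (by omega)) hM
      have hpos : 0 < e₃ := by
        have := hl₁ i₃
        have := hlen0 i₃ hi
        omega
      refine hQ _ _ _ _ _ _ _ _ _ e₃ ?_ hR₃ (Or.inr hpos) le_rfl (fun i hi' => ?_)
        (fun h1 hU hd => ?_) (fun h1 hU hd h2d => ?_)
      · simp; omega
      · have hi' : i < v.n + 1 := hi'
        by_cases hin : i = v.n
        · subst hin
          exact ⟨i₃, hi, by simpa using (hl₁ i₃).trans hlen⟩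
        · exact ⟨i, by omega, by simpa [hin] using hl₁ i⟩
      · have := hsmall h1 hU hd
        omega
      · obtain rfl : i₃ = 0 := by omega
        have : L₁ 0 = v.z := by simpa [h1] using hR₁.sum
        omega
  · intro s₂ k₂ i₂ y₂ hs₂ ho hi hy hf₂
    dsimp only at hs₂ ho hi hy hf₂
    obtain rfl : e₁ = 0 := by omega
    have hlt2 : y₂ < v.p := hy ▸ Nat.mod_lt _ (by omega)
    have hR₂ := hR₁.extend_left ht hi (hy ▸ hf₂)
    rw [← hy] at hR₂
    have hnf : ¬ v.z = v.p := fun hz => by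
      rw [add_zero, hz] at hR₁
      exact hR₁.ne_zero_of_full hlt2 hf₂.1
    refine wp_newIntervalCmd hW hR₂ hn ht rfl hdp ?_ ?_
    · intro s₃ i₃ hs₃ _
      dsimp only at hs₃
      refine hQ _ _ _ _ _ _ _ _ _ 1 ?_ hR₂ (Or.inr one_pos) (Nat.le_succ _) (fun i hi => ⟨i, hi, ?_⟩)
        (fun h1 hU hd => ?_) (fun h1 hU hd h2d => ?_)
      · simp; omega
      · by_cases hii : i = i₂
        · subst hii; have := hl₁ i; simp; omega
        · simpa [hii] using hl₁ i
      · have := hsmall h1 hU hd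
        omega
      -- Prepending `p - 1` to `[0, z)` needs `p - 1 - d < z`. But `2 * d ≤ p` and `z < d` give `p -
      -- 1 - d ≥ d - 1 ≥ z`.
      · exfalso
        obtain rfl : i₂ = 0 := by omega
        rw [h1, add_zero] at hR₁
        have hy' : y₂ = v.p - 1 := by
          rw [hy, hU, zero_add, Nat.mod_eq_of_lt (by omega)]
        obtain ⟨_, hf, _⟩ := hf₂
        have h3 := (hR₁.single_iff hU (Nat.mod_lt _ (by omega))).1 hf.ne'
        rw [hy', show v.p - 1 + v.p - v.del v.t = v.p - 1 - v.del v.t + v.p by omega,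
          Nat.add_mod_right, Nat.mod_eq_of_lt (by omega)] at h3
        omega
    -- No new interval arises after an extension to the left, since `z` has already changed.
    · intro s₃ i₃ y₃ e₃ M₃ hs₃ ho'
      dsimp only at ho'
      omega

/-! ### Growing the reached set to all residues -/

/-- The steps with numbers `2, …, g - 1`: first `h` steps equal to `1`, then `m` steps at most `h`,
then steps between `2` and `p / 2`. -/
structure Steps (p h m g : ℕ) (D : ℕ → ℕ) : Prop where
  pos : 0 < h
  count : g + m = p + 1
  le : 2 + h + m ≤ g
  ones : ∀ t, 2 ≤ t → t < 2 + h → D t = 1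
  pairs : ∀ t, 2 + h ≤ t → t < 2 + h + m → 0 < D t ∧ D t ≤ h
  rest : ∀ t, 2 + h + m ≤ t → t < g → 2 ≤ D t ∧ 2 * D t ≤ p
  large : p ≤ 8 * (h + m)
  small : m = 0 ∨ 8 * (h + m) < p + 8

namespace Steps

variable {p h m g t : ℕ} {D : ℕ → ℕ}

theorem del_pos (hS : Steps p h m g D) (ht : 2 ≤ t) (htg : t < g) : 0 < D t := by
  rcases Nat.lt_or_ge t (2 + h) with h1 | h1
  · rw [hS.ones t ht h1]; exact one_pos
  rcases Nat.lt_or_ge t (2 + h + m) with h2 | h2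
  · exact (hS.pairs t h1 h2).1
  · have := (hS.rest t h2 htg).1
    omega

theorem del_lt (hS : Steps p h m g D) (hp : 2 ≤ p) (ht : 2 ≤ t) (htg : t < g) : D t < p := by
  have := hS.count
  have := hS.le
  rcases Nat.lt_or_ge t (2 + h) with h1 | h1
  · rw [hS.ones t ht h1]; omega
  rcases Nat.lt_or_ge t (2 + h + m) with h2 | h2
  · have := (hS.pairs t h1 h2).2
    omega
  · have := hS.rest t h2 htg
    omega

/-- Before step `t` at least `t - 1` residues are reached; so ones and pairs never exceed the length
of the single interval. -/
theorem del_le (hS : Steps p h m g D) (ht : 2 ≤ t) (htg : t < 2 + h + m) : D t ≤ t - 1 := by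
  rcases Nat.lt_or_ge t (2 + h) with h1 | h1
  · rw [hS.ones t ht h1]; omega
  · have := (hS.pairs t h1 htg).2
    omega

end Steps

/-- The size of the reached set before step `t`, either as a single interval starting at `0`, or
as a union of long intervals. -/
def Progress (p h m t : ℕ) (U L : ℕ → ℕ) (n z : ℕ) : Prop :=
  (n = 1 ∧ U 0 = 0 ∧
    (z = p ∨ t - 1 ≤ z ∧ (2 + h + m ≤ t → 1 + h + m + 2 * (t - (2 + h + m)) ≤ z))) ∨
  (∀ i < n, p ≤ 8 * L i) ∧ (z = p ∨ t - 1 + m ≤ z)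

theorem Reach.n_le {p t n z : ℕ} {D M U L : ℕ → ℕ} (h : Reach p D t M U L n z)
    (hL : ∀ i < n, 0 < L i) : n ≤ p := by
  refine le_trans ?_ h.z_le
  rw [← h.sum]
  have := card_nsmul_le_sum (range n) L 1 fun i hi => hL i (mem_range.1 hi)
  simpa using this

/-- Disjoint intervals of length at least `p / 8` number at most 8. This makes the cost of a step
constant apart from new residues. -/
theorem Progress.n_le {p h m t t' n z : ℕ} {D M U L : ℕ → ℕ} (hP : Progress p h m t U L n z)
    (hR : Reach p D t' M U L n z) (hp : 0 < p) : n ≤ 8 := by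
  rcases hP with ⟨rfl, _⟩ | ⟨hL, _⟩
  · omega
  · have h1 := card_nsmul_le_sum (range n) (fun i => 8 * L i) p fun i hi => hL i (mem_range.1 hi)
    rw [← mul_sum, hR.sum, card_range, smul_eq_mul] at h1
    have := hR.z_le
    by_contra! hn
    nlinarith

theorem Reach.init {p : ℕ} (hp : 2 ≤ p) (D : ℕ → ℕ) :
    Reach p D 1 (update (fun _ => 0) 0 1) (fun _ => 0) (update (fun _ => 0) 0 1) 1 1 where
  le y _ := by
    by_cases h : y = 0 <;> simp [h]
  one_iff y _ := by
    by_cases h : y = 0 <;> simp [h]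
  pred y _ h2 := by
    by_cases h : y = 0 <;> simp [h] at h2
  cover y hy := by
    constructor
    · intro h
      have : y = 0 := by
        by_contra h0
        simp [h0] at h
      exact ⟨0, one_pos, 0, by simp, by simp [this]⟩
    · rintro ⟨i, hi, j, hj, rfl⟩
      obtain rfl : i = 0 := by omega
      obtain rfl : j = 0 := by simpa using hj
      simp
  sum := by simp
  card := by
    rw [card_eq_one]
    refine ⟨0, ?_⟩
    ext y
    by_cases h : y = 0 <;> simp [h]
    omega
  start_lt _ _ := by omega

/-- In the second alternative of `Progress` the reached set is `m` ahead of one residue per step,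
which replaces the `m` steps missing because of the pairs. -/
theorem wp_growCmd {w : ℕ} {v : Vars} [hp : Fact v.p.Prime] {Q : ℕ → State → Prop}
    (hW : Wide w v.p) (hS : Steps v.p v.h v.m v.g v.del) (hM : v.mark = fun _ => 0)
    (hU : v.start = fun _ => 0) (hL : v.len = fun _ => 0)
    (hQ : ∀ s d o i y t M U L n, s ≤ 10000 * v.p →
      Reach v.p v.del (v.g - 1) M U L n v.p →
      Q s {v with d := d, o := o, i := i, y := y, mark := M, start := U, len := L, n := n,
                  z := v.p, t := t}.st) :
    Wp w growCmd v.st Q := by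
  have := hW.big
  have := hW.lin
  have hp2 := hp.out.two_le
  have hcount := hS.count
  have hle := hS.le
  have hpos := hS.pos
  simp (disch := omega) only [growCmd, wp_seq, wp_store, wp_assign, eval_zero, eval_one, eval_two,
    Nat.mod_eq_of_lt, Vars.st_setArr_mark, Vars.st_setArr_len, Vars.st_setReg_n, Vars.st_setReg_z,
    Vars.st_setReg_t, cost_zero, cost_one, cost_two]
  rw [hM, hU, hL]
  -- Amortized time: 6000 for each step, covering work on at most 8 intervals, and 100 for each
  -- reached residue.
  refine wp_loop (fun s u => ∃ d o i y t M U L n z, s ≤ 6000 * (t - 2) + 100 * z ∧ 2 ≤ t ∧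
      t ≤ v.g ∧ Reach v.p v.del (t - 1) M U L n z ∧ (∀ i < n, 0 < L i) ∧
      Progress v.p v.h v.m t U L n z ∧
      u = {v with d := d, o := o, i := i, y := y, mark := M, start := U, len := L, n := n,
                  z := z, t := t})
    (fun u => u.g - u.t) ⟨v.d, v.o, v.i, v.y, 2, _, _, _, 1, 1, by simp, le_rfl, by omega,
      Reach.init hp2 _, ?_, Or.inl ⟨rfl, rfl, Or.inr ⟨le_rfl, by omega⟩⟩, rfl⟩ ?_ ?_
  · intro i hi
    obtain rfl : i = 0 := by omega
    simp
  · rintro s u ⟨d, o, i, y, t, M, U, L, n, z, hs, ht, htg, hR, hL, hP, rfl⟩ htest R hQR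
    rw [eval_lt, ind_mod_wsize (by omega)] at htest
    simp at htest
    have hn := hR.n_le hL
    have hn8 := hP.n_le hR (by omega)
    have hlt : ∀ y < v.p, M y < t := fun y hy => (hR.le y hy).trans_lt (by omega)
    have hz := hR.z_le
    rw [wp_seq]
    refine wp_stepCmd hW (hR.mono (Nat.sub_le _ _)) hlt hL hn ht (hS.del_pos ht htest)
      (hS.del_lt hp2 ht htest) ?_
    intro s' d' o' i' y' M' U' L' n' e hs' hR' hprog hn' hlen hsmall hbig
    dsimp only at hs' hR' hprog hn' hlen hsmall hbig
    have hz' := hR'.z_le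
    simp (disch := omega) only [wp_assign, eval_add, eval_reg, st_reg_t, eval_one,
      Nat.mod_eq_of_lt, Vars.st_setReg_t]
    refine hQR _ _ ⟨d', o', i', y', t + 1, M', U', L', n', z + e, ?_, by omega, htest, hR', ?_, ?_,
      rfl⟩ ?_
    · simp; omega
    · intro i hi
      obtain ⟨k, hk, hkl⟩ := hlen i hi
      exact (hL k hk).trans_le hkl
    · rcases hP with ⟨h1, hU0, hP⟩ | ⟨hlong, hP⟩
      · rcases Nat.lt_or_ge z (v.del t) with hd | hd
        · have htl : 2 + v.h + v.m ≤ t := by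
            by_contra! hcon
            have := hS.del_le ht hcon
            have := hS.del_lt hp2 ht htest
            omega
          have hrest := hS.rest t htl htest
          have he := hbig h1 hU0 hd hrest.2
          have hlarge := hS.large
          refine Or.inr ⟨fun i hi => ?_, Or.inr ?_⟩
          · obtain ⟨k, hk, hkl⟩ := hlen i hi
            obtain rfl : k = 0 := by omega
            have : L 0 = z := by simpa [h1] using hR.sum
            omega
          · omega
        · obtain ⟨h1', hU', he⟩ := hsmall h1 hU0 hd
          refine Or.inl ⟨h1', hU', ?_⟩
          rcases he with he | he
          · exact Or.inl he
          · have := hS.del_pos ht htest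
            rcases hP with hP | ⟨hP1, hP2⟩
            · omega
            · refine Or.inr ⟨by omega, fun htl => ?_⟩
              rcases Nat.lt_or_ge t (2 + v.h + v.m) with h2 | h2
              · omega
              · have := hP2 h2
                have := (hS.rest t h2 htest).1
                omega
      · refine Or.inr ⟨fun i hi => ?_, by omega⟩
        obtain ⟨k, hk, hkl⟩ := hlen i hi
        have := hlong k hk
        omega
    · simp; omega
  · rintro s u ⟨d, o, i, y, t, M, U, L, n, z, hs, ht, htg, hR, hL, hP, rfl⟩ htest
    rw [eval_lt, ind_mod_wsize (by omega)] at htest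
    simp at htest
    obtain rfl : t = v.g := by omega
    have hz := hR.z_le
    have hsmall := hS.small
    have hlarge := hS.large
    -- With `g = p + 1 - m`, the second alternative gives `g - 1 + m = p`. The first gives `1 + h +
    -- m + 2 * (p - 1 - h - 2 * m)`, which is at least `p` since either `m = 0` or `h + m` is only
    -- about `p / 8`.
    obtain rfl : z = v.p := by
      rcases hP with ⟨_, _, hP⟩ | ⟨_, hP⟩ <;> omega
    refine hQ _ _ _ _ _ _ _ _ _ _ ?_ hR
    simp; omega

/-! ### Loops over the elements, backtracking and output -/

theorem wp_forEach {w p : ℕ} {body : Cmd} (K : ℕ) (I : ℕ → Vars → Prop) {v : Vars}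
    {Q : ℕ → State → Prop} (hW : Wide w p) (hp : 0 < p)
    (hI : ∀ i u, I i u → u.i = i ∧ u.p = p) (h0 : I 0 {v with i := 0})
    (hstep : ∀ i u, i < p - 1 → I i u → ∀ R : ℕ → State → Prop,
      (∀ (s : ℕ) (u' : Vars), s ≤ K → u'.i = i → I (i + 1) {u' with i := i + 1} → R s u'.st) → Wp w body u.st R)
    (hQ : ∀ (s : ℕ) (u : Vars), s ≤ (K + 20) * p → I (p - 1) u → Q s u.st) : Wp w (forEach body) v.st Q := by
  have := hW.big
  have := hW.lin
  rw [forEach, wp_seq, wp_assign, Vars.st_setReg_i, eval_zero]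
  refine wp_loop (fun s u => ∃ i, s ≤ (K + 20) * i ∧ i ≤ p - 1 ∧ I i u) (fun u => p - u.i)
    ⟨0, by simp, by simp, h0⟩ ?_ ?_
  · rintro s u ⟨i, hs, hi, hIu⟩ htest R hQR
    obtain ⟨hui, hup⟩ := hI i u hIu
    simp (disch := omega) only [eval_lt, ind_mod_wsize, eval_add, eval_reg, eval_one, st_reg_i,
      st_reg_p, Nat.mod_eq_of_lt, hui, hup, ne_eq, ind_eq_zero, not_not] at htest
    rw [wp_seq]
    refine hstep i u (by omega) hIu _ ?_
    intro s' u' hs' hi' hI'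
    simp (disch := omega) only [wp_assign, eval_add, eval_reg, st_reg_i, eval_one,
      Nat.mod_eq_of_lt, Vars.st_setReg_i, hi']
    refine hQR _ _ ⟨i + 1, ?_, by omega, hI'⟩ ?_
    · rw [mul_add]; simp; omega
    · simp only [hui]; omega
  · rintro s u ⟨i, hs, hi, hIu⟩ htest
    obtain ⟨hui, hup⟩ := hI i u hIu
    simp (disch := omega) only [eval_lt, ind_mod_wsize, eval_add, eval_reg, eval_one, st_reg_i,
      st_reg_p, Nat.mod_eq_of_lt, hui, hup, ind_eq_zero] at htest
    obtain rfl : i = p - 1 := by omega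
    refine hQ _ _ ?_ hIu
    obtain ⟨q, rfl⟩ : ∃ q, p = q + 1 := ⟨p - 1, by omega⟩
    rw [mul_add]
    simp at hs ⊢
    omega

theorem cast_sub_mod {p y d : ℕ} (hd : d ≤ p) :
    (((y + p - d) % p : ℕ) : ZMod p) = y - d := by
  rw [ZMod.natCast_mod, Nat.cast_sub (by omega)]
  simp

theorem wp_selectCmd {w n : ℕ} {v : Vars} {Q : ℕ → State → Prop} (hW : Wide w v.p)
    (hg : 2 ≤ v.g) (hD : ∀ t, 2 ≤ t → t < v.g → v.del t ≤ v.p) (hk : v.k < v.p)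
    (hR : Reach v.p v.del (v.g - 1) v.mark v.start v.len n v.p) (hE : v.sel = fun _ => 0)
    (hQ : ∀ s t E, s ≤ 100 * v.g → (∀ t, E t ≤ 1) →
      (v.k : ZMod v.p) = ∑ t ∈ Ico 2 v.g, (E t : ZMod v.p) * v.del t →
      Q s {v with y := 0, t := t, sel := E}.st) :
    Wp w selectCmd v.st Q := by
  have := hW.big
  have := hW.lin
  simp only [selectCmd, wp_seq, wp_assign, eval_reg, st_reg_k, Vars.st_setReg_y]
  -- The target is always the current residue plus the selected steps, and all selected steps are
  -- later than the mark of the current residue. The decreasing mark bounds the time.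
  refine wp_loop (fun s u => ∃ y t E, s + 50 * v.mark y ≤ 50 * v.g ∧ y < v.p ∧
      (∀ t, E t ≤ 1) ∧ (∀ t, E t ≠ 0 → v.mark y < t) ∧
      (v.k : ZMod v.p) = y + ∑ t ∈ Ico 2 v.g, (E t : ZMod v.p) * v.del t ∧
      u = {v with y := y, t := t, sel := E})
    (fun u => u.mark u.y) ⟨v.k, v.t, v.sel, ?_, hk, by simp [hE], by simp [hE], by simp [hE],
      rfl⟩ ?_ ?_
  · have := hR.le v.k hk
    omega
  · rintro s u ⟨y, t, E, hs, hy, hE1, hE2, hsum, rfl⟩ htest R hQR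
    simp (disch := omega) only [eval_lt, ind_mod_wsize, eval_reg, eval_zero, st_reg_y,
      ne_eq, ind_eq_zero, not_not] at htest
    have h0 := hR.ne_zero_of_full hy
    have h1 := (hR.one_iff y hy).not.2 htest.ne'
    have hle := hR.le y hy
    have hpred := (hR.pred y hy (by omega)).2
    have hd := hD (v.mark y) (by omega) (by omega)
    -- No step is selected twice.
    have hEy : E (v.mark y) = 0 := by
      by_contra h
      exact absurd (hE2 _ h) (lt_irrefl _)
    simp (disch := omega) only [wp_seq, wp_assign, wp_store, eval_load, eval_reg, eval_one,
      eval_mod, eval_sub, eval_add, st_reg_y, st_arr_mark, Vars.st_setReg_t, Vars.st_setArr_sel,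
      Vars.st_setReg_y, st_reg_t, st_reg_p, st_arr_del, Nat.mod_eq_of_lt]
    refine hQR _ _ ⟨(y + v.p - v.del (v.mark y)) % v.p, v.mark y, update E (v.mark y) 1, ?_,
      Nat.mod_lt _ (by omega), ?_, ?_, ?_, rfl⟩ hpred
    · simp; omega
    · intro τ
      by_cases hτ : τ = v.mark y
      · simp [hτ]
      · simpa [hτ] using hE1 τ
    · intro τ
      by_cases hτ : τ = v.mark y
      · subst hτ
        exact fun _ => hpred
      · rw [update_of_ne hτ]
        exact fun h => hpred.trans (hE2 τ h)
    · have hmem : v.mark y ∈ Ico 2 v.g := by simp; omega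
      rw [hsum, cast_sub_mod hd, ← add_sum_erase _ _ hmem, ← add_sum_erase _ _ hmem, update_self,
        hEy]
      have : ∑ t ∈ (Ico 2 v.g).erase (v.mark y),
          ((update E (v.mark y) 1 t : ℕ) : ZMod v.p) * v.del t =
          ∑ t ∈ (Ico 2 v.g).erase (v.mark y), (E t : ZMod v.p) * v.del t :=
        sum_congr rfl fun t ht => by rw [update_of_ne (ne_of_mem_erase ht)]
      rw [this]
      push_cast
      ring
  · rintro s u ⟨y, t, E, hs, hy, hE1, hE2, hsum, rfl⟩ htest
    simp (disch := omega) only [eval_lt, ind_mod_wsize, eval_reg, eval_zero, st_reg_y,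
      ind_eq_zero] at htest
    obtain rfl : y = 0 := by omega
    refine hQ _ _ _ ?_ hE1 (by simpa using hsum)
    simp; omega

theorem wp_outputCmd {w : ℕ} {v : Vars} {Q : ℕ → State → Prop} (hW : Wide w v.p) (hp : 0 < v.p)
    (hF : ∀ i < v.p - 1, v.flip i ≤ 1) (hE : ∀ t, v.sel t ≤ 1)
    (hQ : ∀ (s : ℕ) (u : Vars), s ≤ 100 * v.p →
      (∀ i < v.p - 1, u.out i = (v.flip i + v.sel (v.gad i)) % 2) → Q s u.st) :
    Wp w outputCmd v.st Q := by
  have := hW.big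
  refine wp_forEach 50 (fun i u => ∃ O, (∀ j < i, O j = (v.flip j + v.sel (v.gad j)) % 2) ∧
      u = {v with i := i, out := O}) hW hp ?_ ⟨v.out, by simp, rfl⟩ ?_ ?_
  · rintro i u ⟨O, _, rfl⟩
    exact ⟨rfl, rfl⟩
  · rintro i u hi ⟨O, hO, rfl⟩ R hQR
    have h1 := hF i hi
    have h2 := hE (v.gad i)
    simp (disch := omega) only [wp_store, eval_load, eval_reg, eval_mod, eval_add, eval_two,
      st_reg_i, st_arr_flip, st_arr_sel, st_arr_gad, Nat.mod_eq_of_lt (a := 2),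
      Nat.mod_eq_of_lt (a := _ + _), Vars.st_setArr_out]
    refine hQR _ _ (by simp) rfl ⟨_, fun j hj => ?_, rfl⟩
    by_cases hji : j = i
    · simp [hji]
    · simpa [hji] using hO j (by omega)
  · rintro s u hs ⟨O, hO, rfl⟩
    exact hQ _ _ (by omega) hO

/-! ### Classes up to sign -/

/-- The representative of `x` or `-x` modulo `p` that is at most `p / 2`. -/
def half (p x : ℕ) : ℕ := if p < x + x then p - x else x

theorem two_mul_half_le {p x : ℕ} : 2 * half p x ≤ p := by
  unfold half
  split_ifs <;> omega

theorem half_pos {p x : ℕ} (hx : 0 < x) (hxp : x < p) : 0 < half p x := by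
  unfold half
  split_ifs <;> omega

theorem cast_half {p x : ℕ} (hxp : x < p) :
    (half p x : ZMod p) = x ∨ (half p x : ZMod p) = -x := by
  unfold half
  split_ifs
  · right
    rw [Nat.cast_sub hxp.le]
    simp
  · exact Or.inl rfl

/-- The halves are a system of representatives up to sign: if `p` divides `x + y ≤ p`, then both
numbers are `0` or both are `p / 2`. -/
theorem eq_of_cast_eq {p x y : ℕ} (hp : 2 ≤ p) (hx : 2 * x ≤ p) (hy : 2 * y ≤ p)
    (h : (x : ZMod p) = y ∨ (x : ZMod p) = -y) : x = y := by
  rcases h with h | h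
  · rw [ZMod.natCast_eq_natCast_iff] at h
    exact h.eq_of_lt_of_lt (by omega) (by omega)
  · rw [eq_neg_iff_add_eq_zero, ← Nat.cast_add, ZMod.natCast_eq_zero_iff] at h
    obtain ⟨q, hq⟩ := h
    have : q < 2 := by
      by_contra! h2
      nlinarith
    interval_cases q <;> omega

/-- Scaling by the inverse of the representative of the largest class turns it into the class of
`1`, which then is the largest one. -/
theorem card_scaled_le {p b c h : ℕ} [hp : Fact p.Prime] {a : ℕ → ℕ} (ha : ∀ i < p - 1, a i < p)
    (hbc : (c : ZMod p) * b = 1)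
    (hh : h = #{i ∈ range (p - 1) | half p (a i) = b})
    (hmax : ∀ y, #{i ∈ range (p - 1) | half p (a i) = y} ≤ h) :
    #{i ∈ range (p - 1) | half p (c * a i % p) = 1} = h ∧
      ∀ y, #{i ∈ range (p - 1) | half p (c * a i % p) = y} ≤ h := by
  have hp2 := hp.out.two_le
  have key : ∀ y, #{i ∈ range (p - 1) | half p (c * a i % p) = y} ≤ h := by
    intro y
    -- As `b` inverts `c`, elements whose scaled class is that of `y` had the class of `b * y`
    -- before scaling.
    refine le_trans (card_le_card ?_) (hmax (half p (b * y % p)))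
    intro i
    simp only [mem_filter, mem_range]
    rintro ⟨hi, rfl⟩
    refine ⟨hi, eq_of_cast_eq hp2 two_mul_half_le two_mul_half_le ?_⟩
    have hlt : c * a i % p < p := Nat.mod_lt _ (by omega)
    have h1 := cast_half (ha i hi)
    have h2 := cast_half (p := p) (x := b * half p (c * a i % p) % p) (Nat.mod_lt _ (by omega))
    have h3 := cast_half hlt
    simp only [ZMod.natCast_mod, Nat.cast_mul] at h2 h3
    have h4 : (b : ZMod p) * (c * a i) = a i := by linear_combination (a i : ZMod p) * hbc
    rcases h3 with h3 | h3 <;> rw [h3] at h2 <;> simp only [mul_neg, neg_neg, h4] at h2 <;>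
      rcases h1 with h1 | h1 <;> rcases h2 with h2 | h2 <;> rw [h1, h2] <;> simp
  refine ⟨le_antisymm (key 1) (hh ▸ card_le_card ?_), key⟩
  intro i
  simp only [mem_filter, mem_range]
  rintro ⟨hi, hib⟩
  refine ⟨hi, eq_of_cast_eq hp2 two_mul_half_le (by omega) ?_⟩
  have h1 := cast_half (ha i hi)
  have h3 := cast_half (p := p) (x := c * a i % p) (Nat.mod_lt _ (by omega))
  rw [hib] at h1
  simp only [ZMod.natCast_mod, Nat.cast_mul] at h3
  rcases h1 with h1 | h1 <;> rcases h3 with h3 | h3 <;> rw [h3]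
  · left; rw [← h1, hbc]; simp
  · right; rw [← h1, hbc]; simp
  · right
    push_cast
    linear_combination -hbc - (c : ZMod p) * -h1
  · left
    push_cast
    linear_combination hbc - (c : ZMod p) * h1

/-! ### Making steps out of elements -/

/-- Each of the steps `2, …, g - 1` is a signed sum of elements `γ i`, those with `G i` equal to the
number of the step, the sign being negative if `F i = 1`. For each of the other elements `X i` is the
signed element. -/
structure Assigned (p : ℕ) (γ : ℕ → ZMod p) (G D F X : ℕ → ℕ) (g : ℕ) : Prop where
  gad : ∀ i < p - 1, G i ≠ 0 → 2 ≤ G i ∧ G i < g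
  del : ∀ t, 2 ≤ t → t < g →
    (D t : ZMod p) = ∑ i ∈ range (p - 1) with G i = t, (1 - 2 * (F i : ZMod p)) * γ i
  res : ∀ i < p - 1, G i = 0 → (X i : ZMod p) = (1 - 2 * (F i : ZMod p)) * γ i
  flip : ∀ i < p - 1, F i ≤ 1

/-- The sum `k` of signed elements corresponds to the sum `κ` of elements. -/
def Target (p : ℕ) (γ : ℕ → ZMod p) (κ : ZMod p) (F : ℕ → ℕ) (k : ℕ) : Prop :=
  k < p ∧ (k : ZMod p) = κ - ∑ i ∈ range (p - 1), (F i : ZMod p) * γ i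

section Assign

variable {p g : ℕ} {γ : ℕ → ZMod p} {κ : ZMod p} {G D F X : ℕ → ℕ}

theorem Assigned.single (h : Assigned p γ G D F X g) (hg : 2 ≤ g) {i : ℕ} (hi : i < p - 1)
    (h0 : G i = 0) : Assigned p γ (update G i g) (update D g (X i)) F X (g + 1) where
  gad j hj hne := by
    by_cases hji : j = i
    · subst hji; simp; omega
    · rw [update_of_ne hji] at hne ⊢
      have := h.gad j hj hne
      omega
  del t ht htg := by
    by_cases htt : t = g
    · subst htt
      have : (range (p - 1)).filter (fun j => update G i t j = t) = {i} := by
        ext j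
        by_cases hji : j = i
        · subst hji; simp; omega
        · simp only [mem_filter, mem_range, update_of_ne hji, mem_singleton, hji, iff_false,
            not_and]
          intro hj hGj
          have := h.gad j hj (by omega)
          omega
      rw [this, sum_singleton, update_self, h.res i hi h0]
    · rw [update_of_ne htt, h.del t ht (by omega)]
      refine sum_congr (filter_congr fun j hj => ?_) fun _ _ => rfl
      by_cases hji : j = i
      · subst hji; simp; omega
      · simp [hji]
  res j hj h0' := by
    by_cases hji : j = i
    · subst hji; simp at h0'; omega
    · exact h.res j hj (by simpa [hji] using h0')
  flip := h.flip

theorem cast_one_sub {f : ℕ} (hf : f ≤ 1) : ((1 - f : ℕ) : ZMod p) = 1 - f := by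
  rw [Nat.cast_sub hf, Nat.cast_one]

/-- Negating the smaller signed element turns the pair into one step, the difference. Not taking the
step then means using the smaller element and leaving out the larger one, in terms of the signs
before. The entry `X j` is no longer the signed element, which is harmless because `j` is now
assigned. -/
theorem Assigned.pair (h : Assigned p γ G D F X g) (hg : 2 ≤ g) {i j : ℕ} (hi : i < p - 1)
    (hj : j < p - 1) (hij : i ≠ j) (hi0 : G i = 0) (hj0 : G j = 0) (hX : X j ≤ X i) :
    Assigned p γ (update (update G i g) j g) (update D g (X i - X j)) (update F j (1 - F j)) X
      (g + 1) where
  gad l hl hne := by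
    by_cases hlj : l = j
    · subst hlj; simp; omega
    by_cases hli : l = i
    · subst hli; simp [hlj]; omega
    · simp only [update_of_ne hlj, update_of_ne hli] at hne ⊢
      have := h.gad l hl hne
      omega
  del t ht htg := by
    by_cases htt : t = g
    · subst htt
      have : (range (p - 1)).filter (fun l => update (update G i t) j t l = t) = {i, j} := by
        ext l
        by_cases hlj : l = j
        · subst hlj; simp; omega
        by_cases hli : l = i
        · subst hli; simp [hlj]; omega
        · simp only [mem_filter, mem_range, update_of_ne hli, update_of_ne hlj, mem_insert,
            mem_singleton, hli, hlj, or_false, iff_false, not_and]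
          intro hl hGl
          have := h.gad l hl (by omega)
          omega
      rw [this, sum_pair hij, update_self, update_self, update_of_ne hij, Nat.cast_sub hX,
        h.res i hi hi0, h.res j hj hj0, cast_one_sub (h.flip j hj)]
      ring
    · rw [update_of_ne htt, h.del t ht (by omega)]
      refine sum_congr (filter_congr fun l hl => ?_) fun l hl => ?_
      · by_cases hlj : l = j
        · subst hlj; simp; omega
        by_cases hli : l = i
        · subst hli; simp [hlj]; omega
        · simp [hli, hlj]
      · have hlj : l ≠ j := by
          rintro rfl
          have := (mem_filter.1 hl).2
          simp at this
          omega
        rw [update_of_ne hlj]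
  res l hl h0' := by
    by_cases hlj : l = j
    · subst hlj; simp at h0'; omega
    by_cases hli : l = i
    · subst hli; simp [hlj] at h0'; omega
    · rw [update_of_ne hlj]
      exact h.res l hl (by simpa [hlj, hli] using h0')
  flip l hl := by
    by_cases hlj : l = j
    · subst hlj; simp
    · simpa [hlj] using h.flip l hl

/-- Toggling `F j` changes `F j * γ j` by `(1 - 2 * F j) * γ j`, the signed element `X j`. -/
theorem Target.flip {k : ℕ} (hk : Target p γ κ F k) (h : Assigned p γ G D F X g) {j : ℕ}
    (hj : j < p - 1) (hj0 : G j = 0) (hX : X j ≤ p) :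
    Target p γ κ (update F j (1 - F j)) ((k + p - X j) % p) := by
  refine ⟨Nat.mod_lt _ (by omega), ?_⟩
  have hmem : j ∈ range (p - 1) := mem_range.2 hj
  rw [cast_sub_mod hX, hk.2, h.res j hj hj0, ← add_sum_erase _ _ hmem, ← add_sum_erase _ _ hmem,
    update_self, cast_one_sub (h.flip j hj)]
  have : ∑ i ∈ (range (p - 1)).erase j, ((update F j (1 - F j) i : ℕ) : ZMod p) * γ i =
      ∑ i ∈ (range (p - 1)).erase j, (F i : ZMod p) * γ i :=
    sum_congr rfl fun i hi => by rw [update_of_ne (ne_of_mem_erase hi)]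
  rw [this]
  ring

/-- Selected steps with sum `k` yield selected elements with sum `κ`. -/
theorem sum_selected {k : ℕ} {E : ℕ → ℕ} (hk : Target p γ κ F k) (h : Assigned p γ G D F X g)
    (hG : ∀ i < p - 1, G i ≠ 0) (hE : ∀ t, E t ≤ 1)
    (hsum : (k : ZMod p) = ∑ t ∈ Ico 2 g, (E t : ZMod p) * D t) :
    ∑ i ∈ range (p - 1), (((F i + E (G i)) % 2 : ℕ) : ZMod p) * γ i = κ := by
  have h1 : (k : ZMod p) =
      ∑ i ∈ range (p - 1), (E (G i) : ZMod p) * ((1 - 2 * (F i : ZMod p)) * γ i) := by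
    have hmaps : ∀ i ∈ range (p - 1), G i ∈ Ico 2 g := fun i hi =>
      mem_Ico.2 (h.gad i (mem_range.1 hi) (hG i (mem_range.1 hi)))
    rw [← sum_fiberwise_of_maps_to hmaps, hsum]
    refine sum_congr rfl fun t ht => ?_
    rw [mem_Ico] at ht
    rw [h.del t ht.1 ht.2, mul_sum]
    refine sum_congr rfl fun i hi => ?_
    rw [(mem_filter.1 hi).2]
  have h2 := hk.2.symm.trans h1
  rw [sub_eq_iff_eq_add, ← sum_add_distrib] at h2
  rw [h2]
  refine sum_congr rfl fun i hi => ?_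
  have hf := h.flip i (mem_range.1 hi)
  have he := hE (G i)
  -- For bits, `(F + E) % 2 = F + E * (1 - 2 * F)`: the exclusive or of the sign and the selection.
  interval_cases F i <;> interval_cases E (G i) <;> norm_num

end Assign

/-! ### Stacks -/

/-- A linked list of numbers, pointers being shifted by one, with `0` at the end. -/
def Linked (next : ℕ → ℕ) : ℕ → List ℕ → Prop
  | q, [] => q = 0
  | q, i :: l => q = i + 1 ∧ Linked next (next i) l

theorem Linked.update {next : ℕ → ℕ} {i a : ℕ} {l : List ℕ} (hi : i ∉ l) :
    ∀ {q}, Linked next q l → Linked (update next i a) q l := by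
  induction l with
  | nil => exact id
  | cons j l ih =>
    rintro q ⟨rfl, h⟩
    simp only [List.mem_cons, not_or] at hi
    refine ⟨rfl, ?_⟩
    rw [update_of_ne (Ne.symm hi.1)]
    exact ih hi.2 h

/-- If at most `h` elements have the same value, and unpaired elements with the same quotient by
`h` have the same value, then few elements are unpaired. -/
theorem card_unpaired_le {p h : ℕ} {s : Finset ℕ} {X : ℕ → ℕ}
    (hX : ∀ i ∈ s, 2 * X i ≤ p) (hmax : ∀ y, #{i ∈ s | X i = y} ≤ h)
    (hs : ∀ i ∈ s, ∀ j ∈ s, X i / h = X j / h → X i = X j) : 2 * #s ≤ p + 2 * h := by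
  have h1 : #s ≤ h * #(s.image fun i => X i / h) := by
    refine card_le_mul_card_image s h fun b hb => ?_
    obtain ⟨j, hj, rfl⟩ := mem_image.1 hb
    refine le_trans (card_le_card fun i hi => ?_) (hmax (X j))
    rw [mem_filter] at hi ⊢
    exact ⟨hi.1, hs i hi.1 j hj hi.2⟩
  -- Values at most `p / 2` have at most `p / 2 / h + 1` quotients, and each quotient carries at
  -- most `h` elements.
  have h2 : #(s.image fun i => X i / h) ≤ p / 2 / h + 1 := by
    rw [← card_range (p / 2 / h + 1)]
    refine card_le_card fun b hb => ?_
    obtain ⟨j, hj, rfl⟩ := mem_image.1 hb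
    have := hX j hj
    exact mem_range.2 (Nat.lt_succ_of_le (Nat.div_le_div_right (by omega)))
  have h3 : h * (p / 2 / h) ≤ p / 2 := Nat.mul_div_le _ _
  have h4 := h1.trans (Nat.mul_le_mul_left h h2)
  rw [mul_add, mul_one] at h4
  omega

theorem card_filter_succ (f : ℕ → ℕ) (y i : ℕ) :
    #{j ∈ range (i + 1) | f j = y} = #{j ∈ range i | f j = y} + if f i = y then 1 else 0 := by
  rw [range_add_one, filter_insert]
  split_ifs with h
  · rw [card_insert_of_notMem (by simp)]
  · rfl

theorem card_filter_range_le (f : ℕ → ℕ) (y i : ℕ) : #{j ∈ range i | f j = y} ≤ i :=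
  (card_filter_le _ _).trans (by simp)

/-! ### Counting classes, inverting and scaling -/

theorem wp_halfCmd {w : ℕ} {v : Vars} {Q : ℕ → State → Prop} (hW : Wide w v.p) (hx : v.x < v.p)
    (hQ : ∀ s, s ≤ 10 → Q s {v with x := half v.p v.x}.st) : Wp w halfCmd v.st Q := by
  have := hW.big
  have := hW.lin
  simp (disch := omega) only [halfCmd, wp_branch, wp_assign, wp_skip, eval_sub, eval_add, eval_lt,
    eval_reg, Vars.st_setReg_x, st_reg_p, st_reg_x, ind_mod_wsize, Nat.mod_eq_of_lt, ne_eq,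
    ind_eq_zero, not_not]
  refine ⟨fun h => ?_, fun h => ?_⟩
  · have := hQ (((rp.lt (rx + rx)).cost + 1) + ((rp - rx).cost + 1)) (by simp)
    rwa [half, if_pos h] at this
  · have := hQ ((rp.lt (rx + rx)).cost + 1 + 1) (by simp)
    rwa [half, if_neg h] at this

theorem wp_countCmd {w : ℕ} {v : Vars} {Q : ℕ → State → Prop} (hW : Wide w v.p) (hp : 2 ≤ v.p)
    (ha : ∀ i < v.p - 1, 0 < v.inp i ∧ v.inp i < v.p) (hc : v.cnt = fun _ => 0) (hh : v.h = 0)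
    (hQ : ∀ s i x h b C, s ≤ 100 * v.p → 0 < h → 0 < b → b < v.p →
      h = #{i ∈ range (v.p - 1) | half v.p (v.inp i) = b} →
      (∀ y, #{i ∈ range (v.p - 1) | half v.p (v.inp i) = y} ≤ h) →
      Q s {v with i := i, x := x, h := h, b := b, cnt := C}.st) :
    Wp w countCmd v.st Q := by
  have := hW.big
  have := hW.lin
  refine wp_forEach 60 (fun i u => ∃ x h b C, (∀ y, C y = #{j ∈ range i | half v.p (v.inp j) = y}) ∧
      (∀ y, C y ≤ h) ∧ h ≤ i ∧ (0 < i → 0 < h ∧ 0 < b ∧ b < v.p ∧ C b = h) ∧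
      u = {v with i := i, x := x, h := h, b := b, cnt := C}) hW (by omega) ?_
      ⟨v.x, 0, v.b, v.cnt, by simp [hc], by simp [hc], le_rfl, by simp, by simp [hh]⟩ ?_ ?_
  · rintro i u ⟨x, h, b, C, _, _, _, _, rfl⟩
    exact ⟨rfl, rfl⟩
  · rintro i u hi ⟨x, h, b, C, hC, hCh, hhi, hb, rfl⟩ R hQR
    have hai := ha i hi
    have hCle : ∀ y, C y ≤ i := fun y => by rw [hC]; exact card_filter_range_le _ _ _
    simp only [wp_seq (c₁ := set_x _), wp_seq (c₁ := halfCmd), wp_assign, eval_load, eval_reg,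
      st_reg_i, st_arr_inp, Vars.st_setReg_x]
    refine wp_halfCmd hW hai.2 fun s hs => ?_
    dsimp only
    obtain ⟨x', hx'⟩ : ∃ x', x' = half v.p (v.inp i) := ⟨_, rfl⟩
    rw [← hx']
    have hx0 : 0 < x' := hx' ▸ half_pos hai.1 hai.2
    have hxp : 2 * x' ≤ v.p := hx' ▸ two_mul_half_le
    have := hCle x'
    have hC' : ∀ y, update C x' (C x' + 1) y =
        #{j ∈ range (i + 1) | half v.p (v.inp j) = y} := by
      intro y
      rw [card_filter_succ, ← hC, ← hx']
      by_cases hy : y = x'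
      · simp [hy]
      · simp [hy, Ne.symm hy]
    simp (disch := omega) only [wp_seq, wp_store, wp_branch, wp_assign, wp_skip, eval_load,
      eval_add, eval_one, eval_reg, st_reg_x, st_arr_cnt, Nat.mod_eq_of_lt, Vars.st_setArr_cnt,
      eval_lt, ind_mod_wsize, st_reg_h, Vars.st_setReg_h, Vars.st_setReg_b, update_self, ne_eq,
      ind_eq_zero, not_not]
    refine ⟨fun hlt => ?_, fun hlt => ?_⟩
    · refine hQR _ _ (by simp; omega) rfl ⟨x', C x' + 1, x', _, hC', fun y => ?_, by omega,
        fun _ => ⟨by omega, hx0, by omega, by simp⟩, rfl⟩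
      by_cases hy : y = x'
      · simp [hy]
      · have := hCh y
        simp [hy]; omega
    · have hi0 : 0 < i := by
        by_contra hi0
        have := hCle x'
        omega
      obtain ⟨h1, h2, h3, h4⟩ := hb hi0
      have hbx : b ≠ x' := by rintro rfl; omega
      refine hQR _ _ (by simp; omega) rfl ⟨x', h, b, _, hC', fun y => ?_, by omega,
        fun _ => ⟨h1, h2, h3, by simpa [hbx] using h4⟩, rfl⟩
      by_cases hy : y = x'
      · simp [hy]; omega
      · simpa [hy] using hCh y
  · rintro s u hs ⟨x, h, b, C, hC, hCh, hhi, hb, rfl⟩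
    obtain ⟨h1, h2, h3, h4⟩ := hb (by omega)
    exact hQ _ _ _ _ _ _ (by omega) h1 h2 h3 (by rw [← hC, h4]) fun y => by rw [← hC]; exact hCh y

/-- Exhaustive search suffices: it takes at most `p` tests. The products stay below `p * p`, which
fits in a word. -/
theorem wp_inverseCmd {w : ℕ} {v : Vars} [hp : Fact v.p.Prime] {Q : ℕ → State → Prop}
    (hW : Wide w v.p) (hb0 : 0 < v.b) (hb : v.b < v.p) (hc : v.c = 0)
    (hQ : ∀ s c, s ≤ 100 * v.p → c < v.p → (c : ZMod v.p) * v.b = 1 → Q s {v with c := c}.st) :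
    Wp w inverseCmd v.st Q := by
  have := hW.big
  have := hW.lin
  have := hW.sq
  have hp2 := hp.out.two_le
  have hb' : (v.b : ZMod v.p) ≠ 0 := by
    rw [Ne, ZMod.natCast_eq_zero_iff]
    exact fun h => absurd (Nat.le_of_dvd hb0 h) (by omega)
  obtain ⟨q, hq⟩ : ∃ q, q = ((v.b : ZMod v.p)⁻¹).val := ⟨_, rfl⟩
  have hqp : q < v.p := hq ▸ ZMod.val_lt _
  have hqb : q * v.b % v.p = 1 := by
    have h1 : ((q * v.b : ℕ) : ZMod v.p) = (1 : ℕ) := by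
      rw [Nat.cast_mul, hq, ZMod.natCast_val, ZMod.cast_id, inv_mul_cancel₀ hb', Nat.cast_one]
    rw [ZMod.natCast_eq_natCast_iff, Nat.ModEq, Nat.mod_eq_of_lt (by omega : 1 < v.p)] at h1
    exact h1
  have hmul : ∀ c < v.p, c * v.b < wsize w := fun c hc => by
    have := Nat.mul_lt_mul_of_lt_of_le hc hb.le (by omega)
    omega
  refine wp_loop (fun s u => ∃ c, s ≤ 20 * c ∧ c ≤ q ∧ u = {v with c := c}) (fun u => q - u.c)
    ⟨0, le_rfl, Nat.zero_le _, by rw [← hc]⟩ ?_ ?_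
  · rintro s u ⟨c, hs, hcq, rfl⟩ htest R hQR
    have := hmul c (by omega)
    simp (disch := omega) only [eval_eq, eval_mod, eval_mul, eval_reg, eval_one, eval_zero,
      st_reg_c, st_reg_b, st_reg_p, Nat.mod_eq_of_lt (b := wsize w), ind_mod_wsize, ind_eq_zero,
      ne_eq, not_not] at htest
    have hne : c ≠ q := by rintro rfl; exact htest hqb
    simp (disch := omega) only [wp_assign, eval_add, eval_reg, eval_one, st_reg_c,
      Nat.mod_eq_of_lt, Vars.st_setReg_c]
    refine hQR _ _ ⟨c + 1, by simp; omega, by omega, rfl⟩ (by simp only; omega)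
  · rintro s u ⟨c, hs, hcq, rfl⟩ htest
    have := hmul c (by omega)
    simp (disch := omega) only [eval_eq, eval_mod, eval_mul, eval_reg, eval_one, eval_zero,
      st_reg_c, st_reg_b, st_reg_p, Nat.mod_eq_of_lt (b := wsize w), ind_mod_wsize, ind_eq_zero,
      not_not] at htest
    refine hQ _ c (by simp; omega) (by omega) ?_
    have h1 := congrArg (fun x : ℕ => (x : ZMod v.p)) htest
    simpa using h1

theorem wp_scaleCmd {w : ℕ} {v : Vars} {Q : ℕ → State → Prop}
    (hW : Wide w v.p) (hp : 2 ≤ v.p) (hc : v.c < v.p) (hk : v.k < v.p)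
    (ha : ∀ i < v.p - 1, v.inp i < v.p) (hF : v.flip = fun _ => 0)
    (hQ : ∀ s i x k X F, s ≤ 100 * v.p → (∀ i < v.p - 1, F i ≤ 1) →
      (∀ i < v.p - 1, X i = half v.p (v.c * v.inp i % v.p)) →
      (∀ i < v.p - 1, (X i : ZMod v.p) = (1 - 2 * (F i : ZMod v.p)) * (v.c * v.inp i : ℕ)) →
      Target v.p (fun i => (v.c * v.inp i : ℕ)) (v.c * v.k : ℕ) F k →
      Q s {v with i := i, x := x, k := k, res := X, flip := F}.st) :
    Wp w scaleCmd v.st Q := by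
  have := hW.big
  have := hW.lin
  have := hW.sq
  have hmul : ∀ x < v.p, v.c * x < wsize w := fun x hx => by
    have := Nat.mul_lt_mul_of_lt_of_le hc hx.le (by omega)
    omega
  have := hmul _ hk
  simp (disch := omega) only [scaleCmd, wp_seq (c₁ := set_k _), wp_assign, eval_mod, eval_mul,
    eval_reg, st_reg_c, st_reg_k, st_reg_p, Nat.mod_eq_of_lt (b := wsize w), Vars.st_setReg_k]
  refine wp_forEach 60 (fun i u => ∃ x k X F, (∀ j, F j ≤ 1) ∧ (∀ j, i ≤ j → F j = 0) ∧
      (∀ j < i, X j = half v.p (v.c * v.inp j % v.p)) ∧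
      (∀ j < i, (X j : ZMod v.p) = (1 - 2 * (F j : ZMod v.p)) * (v.c * v.inp j : ℕ)) ∧
      Target v.p (fun i => (v.c * v.inp i : ℕ)) (v.c * v.k : ℕ) F k ∧
      u = {v with i := i, x := x, k := k, res := X, flip := F}) hW (by omega) ?_
      ⟨v.x, v.c * v.k % v.p, v.res, v.flip, by simp [hF], by simp [hF], by simp, by simp,
        ⟨Nat.mod_lt _ (by omega), by simp [hF]⟩, rfl⟩ ?_ ?_
  · rintro i u ⟨x, k, X, F, _, _, _, _, _, rfl⟩
    exact ⟨rfl, rfl⟩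
  · rintro i u hi ⟨x, k, X, F, hF1, hF0, hX, hXF, hT, rfl⟩ R hQR
    have hai := ha i hi
    have := hmul _ hai
    have hx : v.c * v.inp i % v.p < v.p := Nat.mod_lt _ (by omega)
    have hk' := hT.1
    have hFi := hF0 i le_rfl
    have hcast : ((v.c * v.inp i % v.p : ℕ) : ZMod v.p) = (v.c * v.inp i : ℕ) :=
      ZMod.natCast_mod _ _
    have hsum : ∀ f, ∑ j ∈ range (v.p - 1), ((update F i f j : ℕ) : ZMod v.p) *
        (v.c * v.inp j : ℕ) = f * (v.c * v.inp i : ℕ) +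
          ∑ j ∈ range (v.p - 1), (F j : ZMod v.p) * (v.c * v.inp j : ℕ) := fun f => by
      have hmem := mem_range.2 hi
      rw [← add_sum_erase _ _ hmem, ← add_sum_erase _ _ hmem, hFi, update_self]
      simp only [Nat.cast_zero, zero_mul, zero_add]
      exact congrArg _ (sum_congr rfl fun j hj => by rw [update_of_ne (ne_of_mem_erase hj)])
    simp (disch := omega) only [wp_seq, wp_assign, wp_branch, wp_store, wp_skip, eval_mod, eval_mul,
      eval_reg, eval_load, st_reg_c, st_reg_i, st_arr_inp, st_reg_p, Nat.mod_eq_of_lt (b := wsize w),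
      Vars.st_setReg_x, Vars.st_setArr_flip, Vars.st_setReg_k, Vars.st_setArr_res, eval_lt,
      eval_add, eval_sub, st_reg_x, st_reg_k, eval_one, ind_mod_wsize, ne_eq, ind_eq_zero, not_not]
    refine ⟨fun h => ?_, fun h => ?_⟩
    · have hhalf : v.p - v.c * v.inp i % v.p = half v.p (v.c * v.inp i % v.p) := by
        rw [half, if_pos h]
      have hneg : ((v.p - v.c * v.inp i % v.p : ℕ) : ZMod v.p) = -(v.c * v.inp i : ℕ) := by
        rw [Nat.cast_sub hx.le, hcast]; simp
      refine hQR _ _ (by simp) rfl ⟨_, _, _, _, fun j => ?_, fun j hj => ?_, fun j hj => ?_,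
        fun j hj => ?_, ⟨Nat.mod_lt _ (by omega), ?_⟩, rfl⟩
      · by_cases hji : j = i
        · simp [hji]
        · simpa [hji] using hF1 j
      · dsimp only
        rw [update_of_ne (by omega)]
        exact hF0 j (by omega)
      · by_cases hji : j = i
        · subst hji; simpa using hhalf
        · simpa [hji] using hX j (by omega)
      · by_cases hji : j = i
        · subst hji
          simp only [update_self, hneg]
          push_cast
          ring
        · simpa [hji] using hXF j (by omega)
      · rw [ZMod.natCast_mod, Nat.cast_add, hT.2, hneg, hsum]
        push_cast
        ring
    · have hhalf : v.c * v.inp i % v.p = half v.p (v.c * v.inp i % v.p) := by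
        rw [half, if_neg h]
      refine hQR _ _ (by simp) rfl ⟨_, _, _, _, hF1, fun j hj => hF0 j (by omega),
        fun j hj => ?_, fun j hj => ?_, hT, rfl⟩
      · by_cases hji : j = i
        · subst hji; simpa using hhalf
        · simpa [hji] using hX j (by omega)
      · by_cases hji : j = i
        · subst hji
          simp only [update_self, hcast, hFi]
          simp
        · simpa [hji] using hXF j (by omega)
  · rintro s u hs ⟨x, k, X, F, hF1, hF0, hX, hXF, hT, rfl⟩
    exact hQ _ _ _ _ _ _ (by simp; omega) (fun i _ => hF1 i) hX hXF hT

/-! ### Steps made of single elements -/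

theorem wp_singleCmd {w : ℕ} {v : Vars} {Q : ℕ → State → Prop} (hW : Wide w v.p)
    (hg : v.g ≤ v.p + 1)
    (hQ : ∀ s, s ≤ 20 → Q s {v with
      gad := update v.gad v.i v.g, g := v.g + 1, del := update v.del v.g (v.res v.i)}.st) : Wp w singleCmd v.st Q := by
  have := hW.big
  have := hW.lin
  simp (disch := omega) only [singleCmd, wp_seq, wp_store, wp_assign, eval_load, eval_reg,
    eval_add, eval_one, st_reg_i, st_reg_g, st_arr_res, Vars.st_setArr_gad, Vars.st_setArr_del,
    Vars.st_setReg_g, Nat.mod_eq_of_lt]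
  exact hQ _ (by simp)

theorem card_filter_eq_zero_update {G : ℕ → ℕ} {N i g : ℕ} (hi : i < N) (h0 : G i = 0)
    (hg : g ≠ 0) : #{j ∈ range N | update G i g j = 0} + 1 = #{j ∈ range N | G j = 0} := by
  have : (range N).filter (fun j => update G i g j = 0) =
      ((range N).filter fun j => G j = 0).erase i := by
    ext j
    by_cases hj : j = i
    · subst hj; simp [hg]
    · simp [hj]
  rw [this, card_erase_add_one (by simp [hi, h0])]

theorem wp_onesCmd {w : ℕ} {v : Vars} {γ : ℕ → ZMod v.p} {Q : ℕ → State → Prop}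
    (hW : Wide w v.p) (hp : 2 ≤ v.p) (hG : v.gad = fun _ => 0)
    (hF : ∀ i < v.p - 1, v.flip i ≤ 1)
    (hX : ∀ i < v.p - 1, (v.res i : ZMod v.p) = (1 - 2 * (v.flip i : ZMod v.p)) * γ i)
    (hQ : ∀ s i g G D, s ≤ 100 * v.p → g = 2 + #{i ∈ range (v.p - 1) | v.res i = 1} →
      Assigned v.p γ G D v.flip v.res g → (∀ i < v.p - 1, G i = 0 ↔ v.res i ≠ 1) →
      (∀ t, 2 ≤ t → t < g → D t = 1) →
      Q s {v with i := i, g := g, gad := G, del := D}.st) : Wp w onesCmd v.st Q := by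
  have := hW.big
  have := hW.lin
  simp (disch := omega) only [onesCmd, wp_seq, wp_assign, eval_two, Nat.mod_eq_of_lt,
    Vars.st_setReg_g]
  refine wp_forEach 60 (fun i u => ∃ g G D, g = 2 + #{i ∈ range i | v.res i = 1} ∧
      Assigned v.p γ G D v.flip v.res g ∧ (∀ j, G j = 0 ↔ ¬ (j < i ∧ v.res j = 1)) ∧
      (∀ t, 2 ≤ t → t < g → D t = 1) ∧ u = {v with i := i, g := g, gad := G, del := D})
      hW (by omega) ?_ ⟨2, v.gad, v.del, by simp, ?_, by simp [hG], fun t _ _ => by omega, rfl⟩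
      ?_ ?_
  · rintro i u ⟨g, G, D, _, _, _, _, rfl⟩
    exact ⟨rfl, rfl⟩
  · exact ⟨fun i _ h => absurd (by rw [hG]) h, fun t _ _ => by omega, fun i hi _ => hX i hi, hF⟩
  · rintro i u hi ⟨g, G, D, hg, hA, hG0, hD, rfl⟩ R hQR
    have hcard := card_filter_range_le v.res 1 i
    have hsucc := card_filter_succ v.res 1 i
    simp (disch := omega) only [wp_branch, wp_skip, eval_eq, eval_load, eval_reg, eval_one,
      st_reg_i, st_arr_res, Nat.mod_eq_of_lt, ind_mod_wsize, ne_eq, ind_eq_zero, not_not]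
    refine ⟨fun h1 => ?_, fun h1 => ?_⟩
    · have hi0 : G i = 0 := (hG0 i).2 fun h => lt_irrefl _ h.1
      refine wp_singleCmd hW ?_ fun s hs => ?_
      · simp only; omega
      refine hQR _ _ (by simp; omega) rfl ⟨g + 1, _, _, ?_, hA.single (by omega) hi hi0,
        fun j => ?_, fun t ht htg => ?_, rfl⟩
      · rw [hsucc, if_pos h1]; omega
      · by_cases hji : j = i
        · subst hji; simp [h1]; omega
        · have : j < i + 1 ↔ j < i := by omega
          simp only [update_of_ne hji, hG0, this]
      · by_cases htg' : t = g
        · simpa [htg'] using h1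
        · simpa [htg'] using hD t ht (by omega)
    · refine hQR _ _ (by simp) rfl ⟨g, G, D, ?_, hA, fun j => ?_, hD, rfl⟩
      · rw [hsucc, if_neg h1]; omega
      · by_cases hji : j = i
        · subst hji; simp [hG0, h1]
        · have : j < i + 1 ↔ j < i := by omega
          simp only [hG0, this]
  · rintro s u hs ⟨g, G, D, hg, hA, hG0, hD, rfl⟩
    refine hQ _ _ _ _ _ (by simp; omega) hg hA (fun i hi => ?_) hD
    simp [hG0, hi]

theorem wp_restCmd {w : ℕ} {v : Vars} {γ : ℕ → ZMod v.p} {Q : ℕ → State → Prop}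
    (hW : Wide w v.p) (hp : 2 ≤ v.p) (hg2 : 2 ≤ v.g)
    (hg : v.g + #{i ∈ range (v.p - 1) | v.gad i = 0} ≤ v.p + 1)
    (hA : Assigned v.p γ v.gad v.del v.flip v.res v.g)
    (hQ : ∀ s i g G D, s ≤ 100 * v.p → g = v.g + #{i ∈ range (v.p - 1) | v.gad i = 0} →
      Assigned v.p γ G D v.flip v.res g → (∀ i < v.p - 1, G i ≠ 0) →
      (∀ t < v.g, D t = v.del t) →
      (∀ t, v.g ≤ t → t < g → ∃ i < v.p - 1, v.gad i = 0 ∧ D t = v.res i) →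
      Q s {v with i := i, g := g, gad := G, del := D}.st) : Wp w restCmd v.st Q := by
  have := hW.big
  have := hW.lin
  refine wp_forEach 60 (fun i u => ∃ g G D,
      g + #{i ∈ range (v.p - 1) | G i = 0} = v.g + #{i ∈ range (v.p - 1) | v.gad i = 0} ∧
      v.g ≤ g ∧ Assigned v.p γ G D v.flip v.res g ∧ (∀ j < i, G j ≠ 0) ∧
      (∀ j, i ≤ j → G j = v.gad j) ∧ (∀ t < v.g, D t = v.del t) ∧
      (∀ t, v.g ≤ t → t < g → ∃ i < v.p - 1, v.gad i = 0 ∧ D t = v.res i) ∧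
      u = {v with i := i, g := g, gad := G, del := D})
      hW (by omega) ?_ ⟨v.g, v.gad, v.del, by simp, le_rfl, hA, by simp, by simp, by simp,
        fun t _ _ => by omega, rfl⟩ ?_ ?_
  · rintro i u ⟨g, G, D, _, _, _, _, _, _, _, rfl⟩
    exact ⟨rfl, rfl⟩
  · rintro i u hi ⟨g, G, D, hgg, hgle, hA, hG1, hG2, hD1, hD2, rfl⟩ R hQR
    simp (disch := omega) only [wp_branch, wp_skip, eval_eq, eval_load, eval_reg, eval_zero,
      st_reg_i, st_arr_gad, ind_mod_wsize, ne_eq, ind_eq_zero, not_not]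
    refine ⟨fun h1 => ?_, fun h1 => ?_⟩
    · have hc := card_filter_eq_zero_update (g := g) hi h1 (by omega)
      refine wp_singleCmd hW ?_ fun s hs => ?_
      · simp only; omega
      refine hQR _ _ (by simp; omega) rfl ⟨g + 1, _, _, ?_, by omega, hA.single (by omega) hi h1,
        fun j hj => ?_, fun j hj => ?_, fun t ht => ?_, fun t ht htg => ?_, rfl⟩
      · omega
      · by_cases hji : j = i
        · subst hji; simp; omega
        · simpa [hji] using hG1 j (by omega)
      · rw [update_of_ne (by omega)]
        exact hG2 j (by omega)
      · rw [update_of_ne (by omega)]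
        exact hD1 t ht
      · by_cases htg' : t = g
        · exact ⟨i, hi, by rw [← hG2 i le_rfl, h1], by simp [htg']⟩
        · rw [update_of_ne htg']
          exact hD2 t ht (by omega)
    · refine hQR _ _ (by simp) rfl ⟨g, G, D, hgg, hgle, hA, fun j hj => ?_,
        fun j hj => hG2 j (by omega), hD1, hD2, rfl⟩
      rcases Nat.lt_succ_iff_lt_or_eq.1 hj with h | rfl
      · exact hG1 j h
      · exact h1
  · rintro s u hs ⟨g, G, D, hgg, hgle, hA, hG1, hG2, hD1, hD2, rfl⟩
    have : #{i ∈ range (v.p - 1) | G i = 0} = 0 := by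
      rw [card_eq_zero, filter_eq_empty_iff]
      exact fun i hi => hG1 i (mem_range.1 hi)
    exact hQ _ _ _ _ _ (by omega) (by omega) hA hG1 hD1 hD2

/-! ### Pairing elements with small differences -/

/-- For each quotient `b` by `h`, the linked list starting at `head b` contains waiting indices
below `i` of equal elements with quotient `b`. -/
structure Stacks (h i : ℕ) (X G next head : ℕ → ℕ) (S : ℕ → List ℕ) : Prop where
  linked : ∀ b, Linked next (head b) (S b)
  nodup : ∀ b, (S b).Nodup
  mem : ∀ b, ∀ j ∈ S b, j < i ∧ G j = 0 ∧ X j / h = b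
  same : ∀ b, ∀ j ∈ S b, ∀ l ∈ S b, X j = X l

namespace Stacks

variable {h i : ℕ} {X G next head : ℕ → ℕ} {S : ℕ → List ℕ}

theorem succ (hS : Stacks h i X G next head S) : Stacks h (i + 1) X G next head S :=
  { hS with mem := fun b j hj => by have := hS.mem b j hj; omega }

theorem push (hS : Stacks h i X G next head S) (hi : G i = 0)
    (hX : ∀ j ∈ S (X i / h), X j = X i) :
    Stacks h (i + 1) X G (update next i (head (X i / h))) (update head (X i / h) (i + 1))
      (update S (X i / h) (i :: S (X i / h))) := by
  have hni : ∀ b, i ∉ S b := fun b hib => lt_irrefl _ (hS.mem b i hib).1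
  refine ⟨fun b => ?_, fun b => ?_, fun b j hj => ?_, fun b j hj l hl => ?_⟩
  · by_cases hb : b = X i / h
    · subst hb
      simp only [update_self]
      exact ⟨rfl, by rw [update_self]; exact (hS.linked _).update (hni _)⟩
    · simp only [update_of_ne hb]
      exact (hS.linked b).update (hni b)
  · by_cases hb : b = X i / h
    · subst hb; simpa using ⟨hni _, hS.nodup _⟩
    · simpa [hb] using hS.nodup b
  · by_cases hb : b = X i / h
    · subst hb
      simp only [update_self, List.mem_cons] at hj
      rcases hj with rfl | hj
      · exact ⟨by omega, hi, rfl⟩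
      · have := hS.mem _ j hj
        omega
    · rw [update_of_ne hb] at hj
      have := hS.mem b j hj
      omega
  · by_cases hb : b = X i / h
    · subst hb
      simp only [update_self, List.mem_cons] at hj hl
      rcases hj with rfl | hj <;> rcases hl with rfl | hl
      · rfl
      · exact (hX _ hl).symm
      · exact hX _ hj
      · exact hS.same _ j hj l hl
    · rw [update_of_ne hb] at hj hl
      exact hS.same b j hj l hl

theorem pop (hS : Stacks h i X G next head S) {b j : ℕ} {l : List ℕ} (hb : S b = j :: l)
    {G' : ℕ → ℕ} (hG' : ∀ q, q ≠ i → q ≠ j → G' q = G q) :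
    Stacks h (i + 1) X G' next (update head b (next j)) (update S b l) := by
  have hlink := hS.linked b
  have hnod := hS.nodup b
  have hmem := hS.mem b
  have hsame := hS.same b
  rw [hb] at hlink hnod hmem hsame
  have hj := hmem j (by simp)
  rw [List.nodup_cons] at hnod
  refine ⟨fun c => ?_, fun c => ?_, fun c q hq => ?_, fun c q hq q' hq' => ?_⟩
  · by_cases hc : c = b
    · subst hc; simpa using hlink.2
    · simpa [hc] using hS.linked c
  · by_cases hc : c = b
    · subst hc; simpa using hnod.2
    · simpa [hc] using hS.nodup c
  · have hqc : q ∈ S c ∧ q ≠ j := by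
      by_cases hc : c = b
      · subst hc
        rw [update_self] at hq
        rw [hb]
        exact ⟨by simp [hq], fun h => hnod.1 (h ▸ hq)⟩
      · rw [update_of_ne hc] at hq
        refine ⟨hq, ?_⟩
        rintro rfl
        exact hc ((hS.mem c q hq).2.2.symm.trans hj.2.2)
    have := hS.mem c q hqc.1
    rw [hG' q (by omega) hqc.2]
    omega
  · by_cases hc : c = b
    · subst hc
      rw [update_self] at hq hq'
      exact hsame q (by simp [hq]) q' (by simp [hq'])
    · rw [update_of_ne hc] at hq hq'
      exact hS.same c q hq q' hq'

end Stacks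

/-- The invariant of the construction of steps from pairs. -/
structure Pairing (p : ℕ) (γ : ℕ → ZMod p) (κ : ZMod p) (X D₀ : ℕ → ℕ) (h i k g m : ℕ)
    (G D F next head : ℕ → ℕ) : Prop where
  assigned : Assigned p γ G D F X g
  target : Target p γ κ F k
  g_eq : g = 2 + h + m
  card : #{j ∈ range (p - 1) | G j = 0} + h + 2 * m = p - 1
  ones : ∀ t < 2 + h, D t = D₀ t
  pairs : ∀ t, 2 + h ≤ t → t < g → 0 < D t ∧ D t ≤ h
  ne_one : ∀ j < p - 1, G j = 0 → X j ≠ 1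
  unused : ∀ j < p - 1, i ≤ j → X j ≠ 1 → G j = 0
  small : m = 0 ∨ 8 * (h + m) < p + 8
  waiting : ∃ S, Stacks h i X G next head S ∧
    (8 * (h + m) < p → ∀ j < i, G j = 0 → j ∈ S (X j / h))

namespace Pairing

variable {p : ℕ} {γ : ℕ → ZMod p} {κ : ZMod p} {X D₀ : ℕ → ℕ} {h i k g m : ℕ}
  {G D F next head : ℕ → ℕ}

/-- A skipped element is `1`, hence already assigned, or the threshold `p ≤ 8 * (h + m)` is reached.
In the latter case `waiting` no longer requires every unassigned element to be on a stack. -/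
theorem skip (hP : Pairing p γ κ X D₀ h i k g m G D F next head) (hi : i < p - 1)
    (hskip : ¬ (1 < X i ∧ (h + m) * 8 < p)) (hX : ∀ i < p - 1, 0 < X i) :
    Pairing p γ κ X D₀ h (i + 1) k g m G D F next head where
  __ := hP
  unused j hj hij := hP.unused j hj (by omega)
  waiting := by
    obtain ⟨S, hS, hall⟩ := hP.waiting
    refine ⟨S, hS.succ, fun hlt j hj hj0 => ?_⟩
    rcases Nat.lt_succ_iff_lt_or_eq.1 hj with hj | rfl
    · exact hall hlt j hj hj0
    · have := hP.ne_one j hi hj0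
      have := hX j hi
      omega

theorem push (hP : Pairing p γ κ X D₀ h i k g m G D F next head) (hi : i < p - 1)
    (hX : 1 < X i) (htop : head (X i / h) = 0 ∨ X (head (X i / h) - 1) = X i) :
    Pairing p γ κ X D₀ h (i + 1) k g m G D F (update next i (head (X i / h)))
      (update head (X i / h) (i + 1)) where
  __ := hP
  unused j hj hij := hP.unused j hj (by omega)
  waiting := by
    obtain ⟨S, hS, hall⟩ := hP.waiting
    have hi0 := hP.unused i hi le_rfl (by omega)
    refine ⟨_, hS.push hi0 fun j hj => ?_, fun hlt j hj hj0 => ?_⟩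
    · have hl := hS.linked (X i / h)
      have hs := hS.same (X i / h)
      rcases hSb : S (X i / h) with _ | ⟨q, l⟩
      · simp [hSb] at hj
      · rw [hSb] at hl hs hj
        rcases htop with h0 | h1
        · have := hl.1
          omega
        · rw [hl.1, Nat.add_sub_cancel] at h1
          rw [hs j hj q (by simp), h1]
    · by_cases hb : X j / h = X i / h
      · rw [hb, update_self]
        rcases Nat.lt_succ_iff_lt_or_eq.1 hj with hj | rfl
        · exact List.mem_cons_of_mem _ (hb ▸ hall hlt j hj hj0)
        · simp
      · rw [update_of_ne hb]
        rcases Nat.lt_succ_iff_lt_or_eq.1 hj with hj | rfl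
        · exact hall hlt j hj hj0
        · exact absurd rfl hb

/-- The top of a nonempty stack. -/
theorem top (hP : Pairing p γ κ X D₀ h i k g m G D F next head) {b : ℕ} (hb : head b ≠ 0) :
    head b - 1 < i ∧ G (head b - 1) = 0 ∧ X (head b - 1) / h = b := by
  obtain ⟨S, hS, _⟩ := hP.waiting
  have hl := hS.linked b
  have hm := hS.mem b
  rcases hSb : S b with _ | ⟨q, l⟩
  · rw [hSb] at hl
    exact absurd hl hb
  · rw [hSb] at hl hm
    rw [hl.1, Nat.add_sub_cancel]
    exact hm q (by simp)

/-- Numbers with the same quotient by `h` differ by less than `h`, which bounds the new step. A pair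
is made only while `8 * (h + m) < p`, so the sum overshoots the threshold by less than 8, as `small`
asserts. -/
theorem pop (hP : Pairing p γ κ X D₀ h i k g m G D F next head) (hh : 0 < h) (hi : i < p - 1)
    (hXi : 1 < X i) (hm : (h + m) * 8 < p) {j k' d : ℕ} {F' : ℕ → ℕ}
    (hj : head (X i / h) = j + 1)
    (hA : Assigned p γ (update (update G i g) j g) (update D g d) F' X (g + 1))
    (hT : Target p γ κ F' k') (hd : 0 < d) (hd' : X j = X i + d ∨ X i = X j + d) :
    Pairing p γ κ X D₀ h (i + 1) k' (g + 1) (m + 1) (update (update G i g) j g) (update D g d) F'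
      next (update head (X i / h) (next j)) := by
  obtain ⟨hji, hj0, hjb⟩ := hP.top (b := X i / h) (by omega)
  rw [hj, Nat.add_sub_cancel] at hji hj0 hjb
  have hg := hP.g_eq
  have hi0 := hP.unused i hi le_rfl (by omega)
  refine ⟨hA, hT, by omega, ?_, fun t ht => ?_, fun t ht htg => ?_, fun q hq hq0 => ?_,
    fun q hq hiq hq1 => ?_, by omega, ?_⟩
  · have h1 := card_filter_eq_zero_update (g := g) hi hi0 (by omega)
    have h2 := card_filter_eq_zero_update (G := update G i g) (g := g) (i := j) (N := p - 1)
      (by omega) (by rw [update_of_ne (by omega)]; exact hj0) (by omega)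
    have := hP.card
    omega
  · rw [update_of_ne (by omega)]
    exact hP.ones t ht
  · by_cases htg' : t = g
    · subst htg'
      rw [update_self]
      refine ⟨hd, ?_⟩
      have h1 := Nat.div_add_mod (X i) h
      have h2 := Nat.div_add_mod (X j) h
      have h3 := Nat.mod_lt (X i) hh
      have h4 := Nat.mod_lt (X j) hh
      rw [hjb] at h2
      omega
    · rw [update_of_ne htg']
      exact hP.pairs t ht (by omega)
  · by_cases hqj : q = j
    · subst hqj; simp at hq0; omega
    by_cases hqi : q = i
    · subst hqi; omega
    · exact hP.ne_one q hq (by simpa [hqj, hqi] using hq0)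
  · rw [update_of_ne (by omega), update_of_ne (by omega)]
    exact hP.unused q hq (by omega) hq1
  · obtain ⟨S, hS, hall⟩ := hP.waiting
    have hl := hS.linked (X i / h)
    rcases hSb : S (X i / h) with _ | ⟨q, l⟩
    · rw [hSb, hj] at hl
      exact absurd hl (by simp [Linked])
    · rw [hSb, hj] at hl
      obtain rfl : q = j := by have := hl.1; omega
      refine ⟨_, hS.pop hSb fun r hri hrj => by simp [hri, hrj], fun hlt r hr hr0 => ?_⟩
      have hrj : r ≠ q := by
        rintro rfl
        simp at hr0
        omega
      have hri : r ≠ i := by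
        rintro rfl
        rw [update_of_ne hrj, update_self] at hr0
        omega
      rw [update_of_ne hrj, update_of_ne hri] at hr0
      have hmem := hall (by omega) r (by omega) hr0
      by_cases hb : X r / h = X i / h
      · rw [hb, hSb] at hmem
        rw [hb, update_self]
        simpa [hrj] using hmem
      · rwa [update_of_ne hb]

theorem large (hP : Pairing p γ κ X D₀ h (p - 1) k g m G D F next head) (hh : 0 < h)
    (hX : ∀ i < p - 1, 2 * X i ≤ p) (hmax : ∀ y, #{i ∈ range (p - 1) | X i = y} ≤ h) :
    p ≤ 8 * (h + m) := by
  by_contra! hlt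
  obtain ⟨S, hS, hall⟩ := hP.waiting
  have hcard := hP.card
  have := card_unpaired_le (p := p) (h := h) (s := {j ∈ range (p - 1) | G j = 0}) (X := X)
    (fun i hi => hX i (by simpa using (mem_filter.1 hi).1))
    (fun y => le_trans (card_le_card (filter_subset_filter _ (filter_subset _ _))) (hmax y))
    (fun i hi j hj hij => by
      simp only [mem_filter, mem_range] at hi hj
      have h1 := hall hlt i hi.1 hi.2
      have h2 := hall hlt j hj.1 hj.2
      rw [← hij] at h2
      exact hS.same _ i h1 j h2)
  -- Otherwise `2 * (p - 1 - h - 2 * m) ≤ p + 2 * h`, that is `p ≤ 4 * (h + m) + 2`, which is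
  -- incompatible with `8 * (h + m) < p` and `h > 0`.
  omega

end Pairing

theorem wp_pairsCmd {w : ℕ} {v : Vars} {γ : ℕ → ZMod v.p} {κ : ZMod v.p} {Q : ℕ → State → Prop}
    (hW : Wide w v.p) (hp : 2 ≤ v.p) (hh : 0 < v.h)
    (hX : ∀ i < v.p - 1, 0 < v.res i ∧ 2 * v.res i ≤ v.p)
    (hP : ∀ i, i = 0 → Pairing v.p γ κ v.res v.del v.h i v.k v.g v.m v.gad v.del v.flip v.next
      v.head)
    (hmax : ∀ y, #{i ∈ range (v.p - 1) | v.res i = y} ≤ v.h)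
    (hQ : ∀ s i x b j y k g m G D F next head, s ≤ 300 * v.p →
      Pairing v.p γ κ v.res v.del v.h (v.p - 1) k g m G D F next head → v.p ≤ 8 * (v.h + m) →
      Q s {v with i := i, x := x, b := b, j := j, y := y, k := k, g := g, m := m, gad := G,
                  del := D, flip := F, next := next, head := head}.st) :
    Wp w pairsCmd v.st Q := by
  have := hW.big
  have := hW.lin
  refine wp_forEach 200 (fun i u => ∃ x b j y k g m G D F next head,
      Pairing v.p γ κ v.res v.del v.h i k g m G D F next head ∧
      u = {v with i := i, x := x, b := b, j := j, y := y, k := k, g := g, m := m, gad := G,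
                  del := D, flip := F, next := next, head := head})
      hW (by omega) ?_ ⟨_, _, _, _, _, _, _, _, _, _, _, _, hP 0 rfl, rfl⟩ ?_ ?_
  · rintro i u ⟨x, b, j, y, k, g, m, G, D, F, next, head, _, rfl⟩
    exact ⟨rfl, rfl⟩
  · rintro i u hi ⟨x, b, j, y, k, g, m, G, D, F, next, head, hP, rfl⟩ R hQR
    have hXi := hX i hi
    have hcard := hP.card
    have hg := hP.g_eq
    have hk := hP.target.1
    rw [wp_branch]
    simp (disch := omega) only [eval_mul, eval_lt, eval_add, eval_load, eval_reg, eval_one,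
      eval_eight, st_reg_i, st_arr_res, st_reg_h, st_reg_m, st_reg_p,
      Nat.mod_eq_of_lt (b := wsize w), ind_mod_wsize, ind_mul, ne_eq, ind_eq_zero, not_not]
    refine ⟨fun hc => ?_, fun hc => ?_⟩
    · have hi0 := hP.unused i hi le_rfl (by omega)
      simp (disch := omega) only [wp_seq (c₁ := set_x _), wp_seq (c₁ := set_b _),
        wp_seq (c₁ := set_j _), wp_assign, wp_branch, eval_div,
        eval_add, eval_eq, eval_load, eval_sub, eval_reg, eval_one, eval_zero, st_reg_i, st_arr_res,
        st_reg_x, st_reg_h, st_reg_b, st_reg_j, st_arr_head, Vars.st_setReg_x, Vars.st_setReg_b,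
        Vars.st_setReg_j, Nat.mod_eq_of_lt (b := wsize w), ind_mod_wsize]
      -- The sum of two truth values acts as "or". For an empty stack the second one reads the
      -- irrelevant cell `0`, by truncated subtraction.
      have hle1 : ind (head (v.res i / v.h) = 0) ≤ 1 := ind_le
      have hle2 : ind (v.res (head (v.res i / v.h) - 1) = v.res i) ≤ 1 := ind_le
      rw [Nat.mod_eq_of_lt (by omega : ind (head (v.res i / v.h) = 0) +
        ind (v.res (head (v.res i / v.h) - 1) = v.res i) < wsize w)]
      simp only [ne_eq, Nat.add_eq_zero_iff, ind_eq_zero]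
      refine ⟨fun h => ?_, fun h => ?_⟩
      · simp (disch := omega) only [wp_seq, wp_store, eval_load, eval_add, eval_one, eval_reg,
          st_reg_i, st_reg_b, st_arr_head, Vars.st_setArr_next, Vars.st_setArr_head,
          Nat.mod_eq_of_lt (b := wsize w)]
        exact hQR _ _ (by simp) rfl ⟨_, _, _, _, _, _, _, _, _, _, _, _,
          hP.push hi hc.1 (by tauto), rfl⟩
      · obtain ⟨hji, hj0, hjb⟩ := hP.top h.1
        obtain ⟨j', hj'⟩ : ∃ j', head (v.res i / v.h) = j' + 1 :=
          Nat.exists_eq_succ_of_ne_zero h.1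
        have hne := h.2
        rw [hj', Nat.add_sub_cancel] at hji hj0 hjb hne
        have hXj := hX j' (by omega)
        simp (disch := omega) only [pairCmd, wp_seq, wp_store, wp_assign, wp_branch, eval_load,
          eval_sub, eval_add, eval_mod, eval_lt, eval_one, eval_reg, st_reg_i, st_reg_b, st_reg_j,
          st_reg_g, st_reg_x, st_reg_y, st_reg_k, st_reg_p, st_reg_m, st_arr_next,
          st_arr_res, st_arr_flip,
          Vars.st_setArr_head, Vars.st_setArr_gad, Vars.st_setArr_del, Vars.st_setArr_flip,
          Vars.st_setReg_y, Vars.st_setReg_k, Vars.st_setReg_g, Vars.st_setReg_m,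
          Nat.mod_eq_of_lt (b := wsize w), ind_mod_wsize, ne_eq, ind_eq_zero, not_not, hj',
          Nat.add_sub_cancel]
        refine ⟨fun hlt => ?_, fun hlt => ?_⟩
        · refine hQR _ _ (by simp) rfl ⟨_, _, _, _, _, _, _, _, _, _, _, _,
            hP.pop hh hi hc.1 hc.2 hj' ?_ (hP.target.flip hP.assigned hi hi0 (by omega))
            (Nat.sub_pos_of_lt hlt) (by omega), rfl⟩
          -- Here the new element is the smaller one, so the two indices swap roles in
          -- `Assigned.pair`.
          rw [update_comm (by omega)]
          exact hP.assigned.pair (by omega) (by omega) hi (by omega) hj0 hi0 hlt.le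
        · refine hQR _ _ (by simp) rfl ⟨_, _, _, _, _, _, _, _, _, _, _, _,
            hP.pop hh hi hc.1 hc.2 hj' (hP.assigned.pair (by omega) hi (by omega) (by omega) hi0 hj0
              (by omega)) (hP.target.flip hP.assigned (by omega) hj0 (by omega))
            (by omega) (by omega), rfl⟩
    · rw [wp_skip]
      exact hQR _ _ (by simp) rfl ⟨_, _, _, _, _, _, _, _, _, _, _, _,
        hP.skip hi hc fun i hi => (hX i hi).1, rfl⟩
  · rintro s u hs ⟨x, b, j, y, k, g, m, G, D, F, next, head, hP, rfl⟩
    exact hQ _ _ _ _ _ _ _ _ _ _ _ _ _ _ (by omega) hP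
      (hP.large hh (fun i hi => (hX i hi).2) hmax)

/-! ### Assembly and the final bound -/

/-- The program runs in linear time and yields the indicator function of a set of indices of elements
with sum `k`, up to the factor `c`. -/
theorem wp_subsetSumCmd {w : ℕ} {v : Vars} [hpr : Fact v.p.Prime] {Q : ℕ → State → Prop}
    (hW : Wide w v.p) (hk : v.k < v.p) (ha : ∀ i < v.p - 1, 0 < v.inp i ∧ v.inp i < v.p)
    (hz : v.h = 0 ∧ v.c = 0 ∧ v.m = 0)
    (hflip : v.flip = fun _ => 0) (hcnt : v.cnt = fun _ => 0) (hgad : v.gad = fun _ => 0)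
    (hhead : v.head = fun _ => 0) (hmark : v.mark = fun _ => 0) (hstart : v.start = fun _ => 0)
    (hlen : v.len = fun _ => 0) (hsel : v.sel = fun _ => 0)
    (hQ : ∀ (s : ℕ) (u : Vars) (c : ZMod v.p), s ≤ 12000 * v.p → c ≠ 0 →
      (∀ i < v.p - 1, u.out i = 0 ∨ u.out i = 1) →
      ∑ i ∈ range (v.p - 1), (u.out i : ZMod v.p) * (c * v.inp i) = c * v.k → Q s u.st) :
    Wp w subsetSumCmd v.st Q := by
  have hp2 := hpr.out.two_le
  obtain ⟨hh0, hc0, hm0⟩ := hz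
  rw [subsetSumCmd, wp_seq]
  refine wp_countCmd hW hp2 ha hcnt hh0 ?_
  intro s₁ i₁ x₁ h b C hs₁ hh hb0 hb hhb hmax
  rw [wp_seq]
  refine wp_inverseCmd (v := {v with i := i₁, x := x₁, h := h, b := b, cnt := C}) hW hb0 hb hc0 ?_
  intro s₂ c hs₂ hc hcb
  dsimp only at hs₂ hc hcb
  rw [wp_seq]
  refine wp_scaleCmd hW hp2 hc hk (fun i hi => (ha i hi).2) hflip ?_
  intro s₃ i₃ x₃ k X F hs₃ hF hX hXF hT
  dsimp only at hs₃ hF hX hXF hT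
  have hcard := card_scaled_le (fun i hi => (ha i hi).2) hcb hhb hmax
  have hXeq : ∀ y, ({i ∈ range (v.p - 1) | half v.p (c * v.inp i % v.p) = y} : Finset ℕ) =
      {i ∈ range (v.p - 1) | X i = y} := fun y =>
    filter_congr fun i hi => by rw [hX i (mem_range.1 hi)]
  simp only [hXeq] at hcard
  obtain ⟨hone, hmaxX⟩ := hcard
  have hc0' : c ≠ 0 := by
    rintro rfl
    simp at hcb
  have hXpos : ∀ i < v.p - 1, 0 < X i ∧ 2 * X i ≤ v.p := by
    intro i hi
    rw [hX i hi]
    refine ⟨half_pos ?_ (Nat.mod_lt _ (by omega)), two_mul_half_le⟩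
    rw [Nat.pos_iff_ne_zero, Ne, ← Nat.dvd_iff_mod_eq_zero, hpr.out.dvd_mul]
    have := ha i hi
    rintro (h1 | h1)
    · exact absurd (Nat.le_of_dvd (by omega) h1) (by omega)
    · exact absurd (Nat.le_of_dvd (by omega) h1) (by omega)
  rw [wp_seq]
  refine wp_onesCmd hW hp2 hgad hF hXF ?_
  intro s₄ i₄ g₄ G₄ D₄ hs₄ hg₄ hA₄ hG₄ hD₄
  dsimp only at hs₄ hg₄ hA₄ hG₄ hD₄
  rw [hone] at hg₄
  have hcard₄ : #{j ∈ range (v.p - 1) | G₄ j = 0} + h = v.p - 1 := by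
    have h1 : #{j ∈ range (v.p - 1) | G₄ j = 0} + #{j ∈ range (v.p - 1) | ¬ G₄ j = 0} =
        #(range (v.p - 1)) := card_filter_add_card_filter_not _
    rw [card_range] at h1
    have h2 : ({j ∈ range (v.p - 1) | ¬ G₄ j = 0} : Finset ℕ) = {j ∈ range (v.p - 1) | X j = 1} :=
      filter_congr fun i hi => by rw [hG₄ i (mem_range.1 hi), not_not]
    rwa [h2, hone] at h1
  rw [wp_seq]
  refine wp_pairsCmd hW hp2 hh hXpos (fun i hi => ⟨hA₄, hT, ?_, ?_, fun t _ => rfl, ?_, ?_, ?_,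
    Or.inl hm0, fun _ => [], ⟨?_, ?_, ?_, ?_⟩, ?_⟩) hmaxX ?_
  · simp only [hm0]; exact hg₄
  · simp only [hm0]; omega
  · simp only; intro t h1 h2; omega
  · exact fun j hj hj0 => (hG₄ j hj).1 hj0
  · exact fun j hj _ h1 => (hG₄ j hj).2 h1
  · exact fun b => congrFun hhead b
  · simp
  · simp
  · simp
  · intro _ j hj
    omega
  intro s₅ i₅ x₅ b₅ j₅ y₅ k₅ g₅ m G₅ D₅ F₅ N₅ H₅ hs₅ hP hlarge
  dsimp only at hs₅ hP hlarge
  have hcard₅ := hP.card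
  have hg₅ := hP.g_eq
  rw [wp_seq]
  refine wp_restCmd hW hp2 ?_ ?_ hP.assigned ?_
  · simp only; omega
  · simp only; omega
  intro s₆ i₆ g G D hs₆ hg hA hG hD₁ hD₂
  dsimp only at hs₆ hg hA hG hD₁ hD₂
  have hS : Steps v.p h m g D := by
    refine ⟨hh, by omega, by omega, fun t h1 h2 => ?_, fun t h1 h2 => ?_, fun t h1 h2 => ?_, hlarge,
      hP.small⟩
    · rw [hD₁ t (by omega), hP.ones t h2]
      exact hD₄ t h1 (by omega)
    · rw [hD₁ t (by omega)]
      exact hP.pairs t h1 (by omega)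
    · obtain ⟨i, hi, hi0, hDi⟩ := hD₂ t (by omega) h2
      have h3 := hP.ne_one i hi hi0
      have h4 := hXpos i hi
      omega
  rw [wp_seq]
  refine wp_growCmd hW hS hmark hstart hlen ?_
  intro s₇ d₇ o₇ i₇ y₇ t₇ M U L n hs₇ hR
  dsimp only at hs₇ hR
  rw [wp_seq]
  refine wp_selectCmd hW ?_ (fun t h1 h2 => (hS.del_lt hp2 h1 h2).le) hP.target.1 hR hsel ?_
  · simp only; omega
  intro s₈ t₈ E hs₈ hE hsum
  dsimp only at hs₈ hE hsum
  refine wp_outputCmd hW (by simp only; omega) hA.flip hE ?_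
  intro s₉ u hs₉ hu
  dsimp only at hs₉ hu
  have hfinal := sum_selected hP.target hA hG hE hsum
  refine hQ _ u c (by omega) ?_ (fun i hi => ?_) ?_
  · rw [Ne, ZMod.natCast_eq_zero_iff]
    exact fun h1 => absurd (Nat.le_of_dvd (by omega) h1) (by omega)
  · rw [hu i hi]
    omega
  · rw [← Nat.cast_mul, ← hfinal]
    refine sum_congr rfl fun i hi => ?_
    rw [hu i (mem_range.1 hi), ← Nat.cast_mul c]

/-- The exponent 20 makes `p = 2` already give the absolute bound 1000; the other two bounds need
only `p ^ 8` and `p ^ 2`. -/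
theorem Wide.of_pow_le {w p : ℕ} (hp : 2 ≤ p) (h : p ^ 20 ≤ 2 ^ w) : Wide w p := by
  have h1 : 2 ^ 7 ≤ p ^ 7 := Nat.pow_le_pow_left hp 7
  have h2 : p ^ 8 ≤ p ^ 20 := Nat.pow_le_pow_right (by omega) (by norm_num)
  have h3 : p ^ 2 ≤ p ^ 20 := Nat.pow_le_pow_right (by omega) (by norm_num)
  have h4 : 2 ^ 20 ≤ p ^ 20 := Nat.pow_le_pow_left hp 20
  refine ⟨?_, ?_, ?_⟩ <;> rw [wsize_eq]
  · omega
  · have : p ^ 8 = p ^ 7 * p := by ring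
    nlinarith
  · rw [← pow_two]
    omega

end WordRAM

open WordRAM Finset in
theorem solvesSubsetSum_subsetSumCmd {p w : ℕ} (hp : p.Prime) (hw : p ^ 20 ≤ 2 ^ w) :
    SolvesSubsetSum subsetSumCmd w p (12000 * p) := by
  intro k a ha
  have : Fact p.Prime := ⟨hp⟩
  let f : ℕ → ZMod p := fun i => if h : i < p - 1 then a ⟨i, h⟩ else 0
  have hf : ∀ i : Fin (p - 1), f i = a i := fun i => by simp [f]
  let v : Vars :=
    { p := p, k := k.val, i := 0, x := 0, h := 0, b := 0, c := 0, g := 0, m := 0, y := 0, d := 0,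
      t := 0, o := 0, n := 0, z := 0, j := 0, inp := fun i => (f i).val,
      out := fun _ => 0, res := fun _ => 0, flip := fun _ => 0, cnt := fun _ => 0,
      gad := fun _ => 0, del := fun _ => 0, head := fun _ => 0, next := fun _ => 0,
      mark := fun _ => 0, start := fun _ => 0, len := fun _ => 0, sel := fun _ => 0 }
  have hv : subsetSumInput p k a = v.st := by
    refine State.ext (funext fun r => ?_) (funext fun j => funext fun i => ?_)
    · rcases r with _ | _ | r
      · rfl
      · rfl
      · simp only [subsetSumInput]
        rw [if_neg (by omega), if_neg (by omega)]
        dsimp only [Vars.st, v]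
        split <;> first | rfl | omega
    · rcases j with _ | j
      · simp only [subsetSumInput, Vars.st, v, f, true_and]
        split_ifs <;> simp
      · have h0 : v.st.arr (j + 1) = fun _ => 0 := by
          dsimp only [Vars.st, v]
          split <;> first | rfl | omega
        simp only [subsetSumInput]
        rw [dif_neg (by omega), h0]
  rw [hv]
  have hpos : ∀ i < p - 1, 0 < (f i).val := fun i hi => by
    rw [show f i = a ⟨i, hi⟩ from hf ⟨i, hi⟩]
    exact Nat.pos_of_ne_zero (by simpa [ZMod.val_eq_zero] using ha ⟨i, hi⟩)
  obtain ⟨t, s, hex, ht, u, c, hs, hc, hu, hsum⟩ := wp_subsetSumCmd (v := v)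
    (hpr := this) (Q := fun t s => t ≤ 12000 * p ∧ ∃ (u : Vars) (c : ZMod p), s = u.st ∧ c ≠ 0 ∧
      (∀ i < p - 1, u.out i = 0 ∨ u.out i = 1) ∧
      ∑ i ∈ range (p - 1), (u.out i : ZMod p) * (c * (f i).val) = c * k.val)
    (Wide.of_pow_le hp.two_le hw) (ZMod.val_lt k) (fun i hi => ⟨hpos i hi, ZMod.val_lt _⟩)
    ⟨rfl, rfl, rfl⟩ rfl rfl rfl rfl rfl rfl rfl rfl
    (fun s u c h1 h2 h3 h4 => ⟨h1, u, c, rfl, h2, h3, h4⟩)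
  subst hs
  refine ⟨t, _, hex, ht, univ.filter fun i : Fin (p - 1) => u.out i = 1, fun i => ?_, ?_⟩
  · change u.out i = _
    rcases hu i i.2 with h | h <;> simp [h]
  -- The program has solved the instance scaled by the unit `c`, and `c` cancels.
  · refine mul_left_cancel₀ hc ?_
    simp only [ZMod.natCast_val, ZMod.cast_id] at hsum
    rw [← hsum, ← Fin.sum_univ_eq_sum_range (fun i => (u.out i : ZMod p) * (c * f i)), sum_filter,
      mul_sum]
    refine sum_congr rfl fun i _ => ?_
    rw [hf]
    rcases hu i i.2 with h | h <;> simp [h]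

theorem linear_isBigO_mul_log_log (K : ℕ) :
    (fun n : ℕ => ((K * n : ℕ) : ℝ)) =O[atTop] (fun n : ℕ => (n : ℝ) * Real.log (Real.log n)) := by
  have h1 : Tendsto (fun n : ℕ => Real.log (Real.log n)) atTop atTop :=
    Real.tendsto_log_atTop.comp (Real.tendsto_log_atTop.comp tendsto_natCast_atTop_atTop)
  refine IsBigO.of_bound K ?_
  filter_upwards [h1.eventually_ge_atTop 1] with n hn
  rw [Real.norm_of_nonneg (by positivity), Real.norm_of_nonneg (by positivity)]
  push_cast
  have : (n : ℝ) ≤ n * Real.log (Real.log n) := le_mul_of_one_le_right (by positivity) hn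
  exact mul_le_mul_of_nonneg_left this (by positivity)

theorem mainTheorem3 :
    ∃ (P : WordRAM.Cmd) (c : ℕ) (T : ℕ → ℕ),
      (fun n : ℕ => (T n : ℝ)) =O[atTop] (fun n : ℕ => (n : ℝ) * Real.log (Real.log n)) ∧
      ∀ p : ℕ, p.Prime → ∀ w : ℕ, p ^ c ≤ 2 ^ w → SolvesSubsetSum P w p (T p) :=
  ⟨WordRAM.subsetSumCmd, 20, fun n => 12000 * n, linear_isBigO_mul_log_log 12000,
    fun _ hp _ hw => solvesSubsetSum_subsetSumCmd hp hw⟩
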